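/- Let $E,F$ be finite-dimensional complex Hilbert spaces with $\dim E=m$, $\dim F=n$. A subproduct system over $\mathbb N\times\mathbb N$ is a family of finite-dimensional Hilbert spaces $X(s)$, $s\in\mathbb N^2$, with $\dim X(0,0)=1$ and coisometries $U_{s,t}:X(s)\otimes X(t)\to X(s+t)$ that are associative and for which $U_{0,s}$, $U_{s,0}$ are the natural isomorphisms $\mathbb C\otimes X(s)\cong X(s)\cong X(s)\otimes\mathbb C$. Its Fock space is $\mathcal F_X=\bigoplus_s X(s)$ (Hilbert space sum), and its tensor algebra $\mathcal A_X\subset B(\mathcal F_X)$ is the norm-closed algebra generated by the operators $L^{(s)}_\eta$ ($s\in\mathbb N^2$, $\eta\in X(s)$) with $L^{(s)}_\eta\xi=U_{s,t}(\eta\otimes\xi)$ for $\xi\in X(t)$. Its character space $\mathcal M(\mathcal A_X)$ is the set of nonzero multiplicative linear functionals on $\mathcal A_X$ with the weak-* topology. For a unitary $u:F\otimes E\to E\otimes F$ let $W^u_{(i,j),(k,l)}: (E^{\otimes i}\otimes F^{\otimes j})\otimes (E^{\otimes k}\otimes F^{\otimes l})\to E^{\otimes (i+k)}\otimes F^{\otimes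 (j+l)}$ be the unitary that moves the $j$ factors from $F$ past the $k$ factors from $E$ by successive applications of $u$. A subproduct system $X$ with $X(1,0)=E$, $X(0,1)=F$ is standard if $X(i,j)\subset E^{\otimes i}\otimes F^{\otimes j}$ for all $i,j$ and, for some unitary $u:F\otimes E\to E\otimes F$, $U_{s,t}=p_{s+t}W^u_{s,t}|_{X(s)\otimes X(t)}$ for all $s,t$, where $p_s$ is the orthogonal projection onto $X(s)$. A unitary $u:F\otimes E\to E\otimes F$ is a commutation relation for $X$ if $p_{(1,1)}u=(U_{(1,0),(0,1)})^*U_{(0,1),(1,0)}$. A polynomial in $\mathbb C[z_1,\dots,z_m,w_1,\dots,w_n]$ is $(m,n)$-homogeneous if all its monomials have the same degree in the variables $z$ and the same degree in the variables $w$; an ideal is $(m,n)$-homogeneous if it is generated by $(m,n)$-homogeneous polynomials. For a set $I$ of polynomials put $$\Omega^{m,n}(I)=\{(z,w)\in\mathbb C^m\times\mathbb C^n:\ p(z,w)=0\ \ \forall p\in I,\ \|z\|\le1,\ \|w\|\le 1\}$$ (Euclidean norms). Theorem. Let $X$ be a standard subproduct system with $X(1,0)=E$, $X(0,1)=F$,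 $\dim E=m$, $\dim F=n$, and let $u$ be a commutation relation for $X$. Then there is an $(m,n)$-homogeneous ideal $J$ such that $\mathcal M(\mathcal A_X)$ is homeomorphic to $\Omega^{m,n}(J)$. More specifically, for any orthonormal bases $e_1,\dots,e_m$ of $E$ and $f_1,\dots,f_n$ of $F$, one may take for $J$ the ideal generated by the polynomials $$p_{i,j}=w_jz_i-\sum_{k=1}^m\sum_{l=1}^n u_{(k,l),(i,j)}z_kw_l,\qquad u_{(k,l),(i,j)}=\text{the coefficient of } e_k\otimes f_l\text{ in } u(f_j\otimes e_i),$$ for $1\le i\le m$, $1\le j\le n$, together with all the polynomials $q^x$ for $x\in (E^{\otimes i}\otimes F^{\otimes j})\ominus X(i,j)$, $i,j\ge0$. Here, for $x=\sum a_{s_1,\dots,s_i}^{t_1,\dots,t_j}\,e_{s_1}\otimes\cdots\otimes e_{s_i}\otimes f_{t_1}\otimes\cdots\otimes f_{t_j}$, $$q^x=\sum a_{s_1,\dots,s_i}^{t_1,\dots,t_j}\,z_{s_1}\cdots z_{s_i}w_{t_1}\cdots w_{t_j}.$$ This ideal $J$ is $(m,n)$-homogeneous. -/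

import Mathlib

open scoped TensorProduct
open Module

noncomputable section

universe u v w

/-! ### Tensor powers of Hilbert spaces -/

/-- A bundled complex inner product space. -/
structure HilbSp : Type (u + 1) where
  carrier : Type u
  [instGroup : NormedAddCommGroup carrier]
  [instInner : InnerProductSpace ℂ carrier]

attribute [instance] HilbSp.instGroup HilbSp.instInner

/-- The scalars `ℂ`, as a Hilbert space in an arbitrary universe. -/
def HilbSp.scalars : HilbSp.{u} :=
  letI : InnerProductSpace ℂ (ULift.{u} ℂ) :=
    { (inferInstance : NormedSpace ℂ (ULift.{u} ℂ)) with
      inner := fun x y => inner ℂ x.down y.down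
      norm_sq_eq_re_inner := fun x => norm_sq_eq_re_inner (𝕜 := ℂ) x.down
      conj_inner_symm := fun x y => inner_conj_symm x.down y.down
      add_left := fun x y z => inner_add_left x.down y.down z.down
      smul_left := fun x y r => inner_smul_left x.down y.down r }
  ⟨ULift.{u} ℂ⟩

/-- The tensor power `E^{⊗ n}`, with `E^{⊗ 0} = ℂ` and `E^{⊗ (n+1)} = E ⊗ E^{⊗ n}`. -/
def hilbPow (E : Type u) [NormedAddCommGroup E] [InnerProductSpace ℂ E] : ℕ → HilbSp.{u}
  | 0 => HilbSp.scalars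
  | n + 1 => ⟨E ⊗[ℂ] (hilbPow E n).carrier⟩

/-- The underlying type of `E^{⊗ n}`. -/
abbrev TPow (E : Type u) [NormedAddCommGroup E] [InnerProductSpace ℂ E] (n : ℕ) : Type u :=
  (hilbPow E n).carrier

section Pow

variable (E : Type u) [NormedAddCommGroup E] [InnerProductSpace ℂ E]

/-- `E^{⊗ 0} = ℂ`. -/
def tpowZero : TPow E 0 ≃ₗᵢ[ℂ] ℂ where
  toLinearEquiv := (ULift.moduleEquiv : ULift.{u} ℂ ≃ₗ[ℂ] ℂ)
  norm_map' := fun _ => rfl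

/-- `E^{⊗ (n+1)} = E ⊗ E^{⊗ n}`. -/
def tpowSucc (n : ℕ) : TPow E (n + 1) ≃ₗᵢ[ℂ] E ⊗[ℂ] TPow E n :=
  LinearIsometryEquiv.refl ℂ (E ⊗[ℂ] (hilbPow E n).carrier)

instance tpow_finiteDimensional [FiniteDimensional ℂ E] (n : ℕ) :
    FiniteDimensional ℂ (TPow E n) := by
  induction n with
  | zero => exact (tpowZero E).symm.toLinearEquiv.finiteDimensional
  | succ n ih => exact (tpowSucc E n).symm.toLinearEquiv.finiteDimensional

variable {E}

/-- The elementary tensor `v₀ ⊗ v₁ ⊗ ⋯ ⊗ v_{n-1}` in `E^{⊗ n}`. -/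
def elemTensor : (n : ℕ) → (Fin n → E) → TPow E n
  | 0, _ => (tpowZero E).symm 1
  | n + 1, v => (tpowSucc E n).symm (v 0 ⊗ₜ[ℂ] elemTensor n (Fin.tail v))

variable (E)

/-- Concatenation of tensors `E^{⊗ i} ⊗ E^{⊗ k} ≅ E^{⊗ (i + k)}`
(the exponent is written as `k + i`, so that both sides unfold by recursion on `i`). -/
def tpowConcat : (i k : ℕ) → TPow E i ⊗[ℂ] TPow E k ≃ₗᵢ[ℂ] TPow E (k + i)
  | 0, k =>
    ((tpowZero E).rTensor (TPow E k)).trans (TensorProduct.lidIsometry ℂ (TPow E k))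
  | i + 1, k =>
    (((tpowSucc E i).rTensor (TPow E k)).trans
      (TensorProduct.assocIsometry ℂ E (TPow E i) (TPow E k))).trans
      (((tpowConcat i k).lTensor E).trans (tpowSucc E (k + i)).symm)

end Pow

/-! ### The commutation operators -/

section Comm

variable {E : Type u} {F : Type v} [NormedAddCommGroup E] [InnerProductSpace ℂ E]
  [NormedAddCommGroup F] [InnerProductSpace ℂ F]

/-- `u^{(1,n)} : F ⊗ E^{⊗ n} → E^{⊗ n} ⊗ F`, moving the factor from `F` through the factors of
`E^{⊗ n}` from left to right, each time by an application of `u`. -/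
def commOne (u : F ⊗[ℂ] E ≃ₗᵢ[ℂ] E ⊗[ℂ] F) :
    (n : ℕ) → F ⊗[ℂ] TPow E n ≃ₗᵢ[ℂ] TPow E n ⊗[ℂ] F
  | 0 =>
    (((tpowZero E).lTensor F).trans
      (TensorProduct.commIsometry ℂ F ℂ)).trans ((tpowZero E).symm.rTensor F)
  | n + 1 =>
    -- `F ⊗ (E ⊗ Eⁿ) → (F ⊗ E) ⊗ Eⁿ → (E ⊗ F) ⊗ Eⁿ → E ⊗ (F ⊗ Eⁿ) → E ⊗ (Eⁿ ⊗ F) → (E ⊗ Eⁿ) ⊗ F`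
    ((tpowSucc E n).lTensor F).trans <|
    (TensorProduct.assocIsometry ℂ F E (TPow E n)).symm.trans <|
    (u.rTensor (TPow E n)).trans <|
    (TensorProduct.assocIsometry ℂ E F (TPow E n)).trans <|
    ((commOne u n).lTensor E).trans <|
    (TensorProduct.assocIsometry ℂ E (TPow E n) F).symm.trans <|
    (tpowSucc E n).symm.rTensor F

/-- `u^{(m,n)} : F^{⊗ m} ⊗ E^{⊗ n} → E^{⊗ n} ⊗ F^{⊗ m}`, moving the `m` factors from `F` one by
one through `E^{⊗ n}` by `u^{(1,n)}`, the rightmost factor first. -/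
def commMany (u : F ⊗[ℂ] E ≃ₗᵢ[ℂ] E ⊗[ℂ] F) :
    (m n : ℕ) → TPow F m ⊗[ℂ] TPow E n ≃ₗᵢ[ℂ] TPow E n ⊗[ℂ] TPow F m
  | 0, n =>
    (((tpowZero F).rTensor (TPow E n)).trans
      (TensorProduct.commIsometry ℂ ℂ (TPow E n))).trans ((tpowZero F).symm.lTensor (TPow E n))
  | m + 1, n =>
    -- `(F ⊗ Fᵐ) ⊗ Eⁿ → F ⊗ (Fᵐ ⊗ Eⁿ) → F ⊗ (Eⁿ ⊗ Fᵐ) → (F ⊗ Eⁿ) ⊗ Fᵐ → (Eⁿ ⊗ F) ⊗ Fᵐ → Eⁿ ⊗ (F ⊗ Fᵐ)`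
    ((tpowSucc F m).rTensor (TPow E n)).trans <|
    (TensorProduct.assocIsometry ℂ F (TPow F m) (TPow E n)).trans <|
    ((commMany u m n).lTensor F).trans <|
    (TensorProduct.assocIsometry ℂ F (TPow E n) (TPow F m)).symm.trans <|
    ((commOne u n).rTensor (TPow F m)).trans <|
    (TensorProduct.assocIsometry ℂ (TPow E n) F (TPow F m)).trans <|
    (tpowSucc F m).symm.lTensor (TPow E n)

variable (E F) in
/-- The Hilbert space `E^{⊗ i} ⊗ F^{⊗ j}` for `s = (i, j)`. -/
abbrev BiPow (s : ℕ × ℕ) : Type (max u v) := TPow E s.1 ⊗[ℂ] TPow F s.2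

/-- The multiplication operator
`W^u_{s,t} : (E^{⊗ i} ⊗ F^{⊗ j}) ⊗ (E^{⊗ k} ⊗ F^{⊗ l}) → E^{⊗ (i+k)} ⊗ F^{⊗ (j+l)}`
for `s = (i, j)`, `t = (k, l)`, given by `I ⊗ u^{(j,k)} ⊗ I`. -/
def mulW (u : F ⊗[ℂ] E ≃ₗᵢ[ℂ] E ⊗[ℂ] F) (s t : ℕ × ℕ) :
    BiPow E F s ⊗[ℂ] BiPow E F t ≃ₗᵢ[ℂ] BiPow E F (t + s) :=
  -- `(Eⁱ ⊗ Fʲ) ⊗ (Eᵏ ⊗ Fˡ) → Eⁱ ⊗ (Fʲ ⊗ (Eᵏ ⊗ Fˡ)) → Eⁱ ⊗ ((Fʲ ⊗ Eᵏ) ⊗ Fˡ)`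
  -- `→ Eⁱ ⊗ ((Eᵏ ⊗ Fʲ) ⊗ Fˡ) → Eⁱ ⊗ (Eᵏ ⊗ (Fʲ ⊗ Fˡ)) → (Eⁱ ⊗ Eᵏ) ⊗ (Fʲ ⊗ Fˡ) → Eⁱ⁺ᵏ ⊗ Fʲ⁺ˡ`
  (TensorProduct.assocIsometry ℂ (TPow E s.1) (TPow F s.2) (BiPow E F t)).trans <|
  (LinearIsometryEquiv.lTensor (TPow E s.1)
    ((TensorProduct.assocIsometry ℂ (TPow F s.2) (TPow E t.1) (TPow F t.2)).symm.trans <|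
      ((commMany u s.2 t.1).rTensor (TPow F t.2)).trans <|
      TensorProduct.assocIsometry ℂ (TPow E t.1) (TPow F s.2) (TPow F t.2))).trans <|
  (TensorProduct.assocIsometry ℂ (TPow E s.1) (TPow E t.1)
    (TPow F s.2 ⊗[ℂ] TPow F t.2)).symm.trans <|
  TensorProduct.congrIsometry (tpowConcat E s.1 t.1) (tpowConcat F s.2 t.2)

variable (E) in
/-- `E = E^{⊗ 1}`. -/
def tpowOne : E ≃ₗᵢ[ℂ] TPow E 1 :=
  ((TensorProduct.ridIsometry ℂ E).symm.trans ((tpowZero E).symm.lTensor E)).trans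
    (tpowSucc E 0).symm

variable (E F) in
/-- `E = E^{⊗ 1} ⊗ F^{⊗ 0}`. -/
def embE : E ≃ₗᵢ[ℂ] BiPow E F (1, 0) :=
  ((tpowOne E).trans (TensorProduct.ridIsometry ℂ (TPow E 1)).symm).trans
    ((tpowZero F).symm.lTensor (TPow E 1))

variable (E F) in
/-- `F = E^{⊗ 0} ⊗ F^{⊗ 1}`. -/
def embF : F ≃ₗᵢ[ℂ] BiPow E F (0, 1) :=
  ((tpowOne F).trans (TensorProduct.lidIsometry ℂ (TPow F 1)).symm).trans
    ((tpowZero E).symm.rTensor (TPow F 1))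

variable (E F) in
/-- `E ⊗ F = E^{⊗ 1} ⊗ F^{⊗ 1}`. -/
def embEF : E ⊗[ℂ] F ≃ₗᵢ[ℂ] BiPow E F (1, 1) :=
  TensorProduct.congrIsometry (tpowOne E) (tpowOne F)

end Comm

/-! ### Subproduct systems over `ℕ × ℕ` and their tensor algebras -/

/-- A subproduct system (of finite-dimensional Hilbert spaces) over `ℕ × ℕ` with fibres `X s`.
The coisometries `U_{s,t} : X s ⊗ X t → X r` are given for all `r` with a proof of `s + t = r`. -/
structure SubproductSystem (X : ℕ × ℕ → Type w) [∀ s, NormedAddCommGroup (X s)]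
    [∀ s, InnerProductSpace ℂ (X s)] [∀ s, FiniteDimensional ℂ (X s)] where
  finrank_zero : finrank ℂ (X 0) = 1
  /-- the unit vector by which `X 0` is identified with `ℂ` -/
  vac : X 0
  norm_vac : ‖vac‖ = 1
  U : ∀ {s t r : ℕ × ℕ}, s + t = r → X s ⊗[ℂ] X t →ₗ[ℂ] X r
  coisometry : ∀ {s t r : ℕ × ℕ} (h : s + t = r),
    U h ∘ₗ LinearMap.adjoint (U h) = LinearMap.id
  vac_mul : ∀ (s : ℕ × ℕ) (x : X s), U (zero_add s) (vac ⊗ₜ[ℂ] x) = x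
  mul_vac : ∀ (s : ℕ × ℕ) (x : X s), U (add_zero s) (x ⊗ₜ[ℂ] vac) = x
  assoc : ∀ {s t r a b c : ℕ × ℕ} (hst : s + t = a) (har : a + r = c) (htr : t + r = b)
    (hsb : s + b = c) (x : X s) (y : X t) (z : X r),
    U har (U hst (x ⊗ₜ[ℂ] y) ⊗ₜ[ℂ] z) = U hsb (x ⊗ₜ[ℂ] U htr (y ⊗ₜ[ℂ] z))

namespace SubproductSystem

variable {X : ℕ × ℕ → Type w} [∀ s, NormedAddCommGroup (X s)]
    [∀ s, InnerProductSpace ℂ (X s)] [∀ s, FiniteDimensional ℂ (X s)]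

/-- The `X`-Fock space: the Hilbert space direct sum of the fibres. -/
abbrev Fock (X : ℕ × ℕ → Type w) [∀ s, NormedAddCommGroup (X s)] : Type w := lp X 2

theorem norm_le_of_coisometry {V : Type*} {W : Type*} [NormedAddCommGroup V]
    [InnerProductSpace ℂ V] [FiniteDimensional ℂ V] [NormedAddCommGroup W] [InnerProductSpace ℂ W]
    [FiniteDimensional ℂ W] (T : V →ₗ[ℂ] W) (hT : T ∘ₗ LinearMap.adjoint T = LinearMap.id) (x : V) :
    ‖T x‖ ≤ ‖x‖ := by
  have hadj : ∀ y, ‖LinearMap.adjoint T y‖ = ‖y‖ := by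
    intro y
    have h1 : inner ℂ (LinearMap.adjoint T y) (LinearMap.adjoint T y) = inner ℂ y y := by
      rw [LinearMap.adjoint_inner_left]
      have := LinearMap.congr_fun hT y
      simp only [LinearMap.comp_apply, LinearMap.id_apply] at this
      rw [this]
    rw [inner_self_eq_norm_sq_to_K, inner_self_eq_norm_sq_to_K] at h1
    have h2 : ‖LinearMap.adjoint T y‖ ^ 2 = ‖y‖ ^ 2 := by exact_mod_cast h1
    exact (sq_eq_sq₀ (norm_nonneg _) (norm_nonneg _)).1 h2
  have h3 : ‖T x‖ * ‖T x‖ ≤ ‖x‖ * ‖T x‖ := by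
    have h4 : inner ℂ (T x) (T x) = inner ℂ x (LinearMap.adjoint T (T x)) := by
      rw [LinearMap.adjoint_inner_right]
    have h5 : ‖(inner ℂ (T x) (T x) : ℂ)‖ = ‖T x‖ * ‖T x‖ := by
      rw [inner_self_eq_norm_sq_to_K]; simp [sq]
    rw [← h5, h4]
    refine (norm_inner_le_norm _ _).trans ?_
    rw [hadj]
  rcases (norm_nonneg (T x)).eq_or_lt with h0 | h0
  · rw [← h0]; exact norm_nonneg _
  · exact le_of_mul_le_mul_right h3 h0

theorem norm_U_le (S : SubproductSystem X) {s t r : ℕ × ℕ} (h : s + t = r)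
    (x : X s ⊗[ℂ] X t) : ‖S.U h x‖ ≤ ‖x‖ :=
  norm_le_of_coisometry (S.U h) (S.coisometry h) x

/-- The `r`-th coordinate of `L_η ξ`: it is `U_{s,t} (η ⊗ ξ_t)` if `r = s + t`, and `0` if `r`
is not of this form. -/
def creationFun (S : SubproductSystem X) {s : ℕ × ℕ} (η : X s) (ξ : ∀ t, X t) (r : ℕ × ℕ) : X r :=
  if h : s ≤ r then S.U (add_tsub_cancel_of_le h) (η ⊗ₜ[ℂ] ξ (r - s)) else 0

theorem sum_creationFun_le (S : SubproductSystem X) {s : ℕ × ℕ} (η : X s) (ξ : lp X 2)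
    (A : Finset (ℕ × ℕ)) :
    ∑ r ∈ A, ‖S.creationFun η ξ r‖ ^ (2 : ENNReal).toReal
      ≤ (‖η‖ * ‖ξ‖) ^ (2 : ENNReal).toReal := by
  classical
  have hp : (0 : ℝ) < (2 : ENNReal).toReal := by norm_num
  rw [Real.mul_rpow (norm_nonneg _) (norm_nonneg _)]
  calc ∑ r ∈ A, ‖S.creationFun η ξ r‖ ^ (2 : ENNReal).toReal
      = ∑ r ∈ A with s ≤ r, ‖S.creationFun η ξ r‖ ^ (2 : ENNReal).toReal := by
        rw [Finset.sum_filter]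
        refine Finset.sum_congr rfl fun r _ => ?_
        split_ifs with h
        · rfl
        · simp [creationFun, h]
    _ ≤ ∑ r ∈ A with s ≤ r, ‖η‖ ^ (2 : ENNReal).toReal *
          ‖ξ (r - s)‖ ^ (2 : ENNReal).toReal := by
        refine Finset.sum_le_sum fun r hr => ?_
        have h : s ≤ r := (Finset.mem_filter.1 hr).2
        rw [← Real.mul_rpow (norm_nonneg _) (norm_nonneg _)]
        refine Real.rpow_le_rpow (norm_nonneg _) ?_ hp.le
        simp only [creationFun, h, dif_pos]
        refine (S.norm_U_le _ _).trans ?_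
        rw [TensorProduct.norm_tmul]
    _ = ‖η‖ ^ (2 : ENNReal).toReal *
          ∑ t ∈ (A.filter (s ≤ ·)).image (· - s), ‖ξ t‖ ^ (2 : ENNReal).toReal := by
        rw [Finset.sum_image, Finset.mul_sum]
        intro a ha b hb hab
        have ha' : s ≤ a := (Finset.mem_filter.1 ha).2
        have hb' : s ≤ b := (Finset.mem_filter.1 hb).2
        rw [← add_tsub_cancel_of_le ha', ← add_tsub_cancel_of_le hb']
        exact congrArg (s + ·) hab
    _ ≤ _ := by
        refine mul_le_mul_of_nonneg_left (lp.sum_rpow_le_norm_rpow hp ξ _) ?_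
        positivity

/-- The creation operator `L_η^{(s)}` on the Fock space, for `η ∈ X s`. -/
def creation (S : SubproductSystem X) {s : ℕ × ℕ} (η : X s) : Fock X →L[ℂ] Fock X :=
  LinearMap.mkContinuous
    { toFun := fun ξ => ⟨S.creationFun η ξ, memℓp_gen' (S.sum_creationFun_le η ξ)⟩
      map_add' := fun ξ ζ => by
        ext r
        simp only [lp.coeFn_add, Pi.add_apply, creationFun]
        split_ifs <;> simp [TensorProduct.tmul_add]
      map_smul' := fun c ξ => by
        ext r
        simp only [lp.coeFn_smul, Pi.smul_apply, creationFun, RingHom.id_apply]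
        split_ifs <;> simp }
    ‖η‖
    (fun ξ => lp.norm_le_of_forall_sum_le (by norm_num) (by positivity)
      (S.sum_creationFun_le η ξ))

/-- The defining property of the creation operator: it maps `ξ ∈ X t` to `U_{s,t} (η ⊗ ξ)`. -/
theorem creation_single (S : SubproductSystem X) {s t r : ℕ × ℕ} (h : s + t = r) (η : X s)
    (ξ : X t) : S.creation η (lp.single 2 t ξ) = lp.single 2 r (S.U h (η ⊗ₜ[ℂ] ξ)) := by
  subst h
  ext r
  change S.creationFun η (lp.single 2 t ξ : lp X 2) r = _
  by_cases hr : r = s + t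
  · subst hr
    have key : ∀ (t' : ℕ × ℕ) (ht' : s + t' = s + t), t' = t →
        S.U ht' (η ⊗ₜ[ℂ] (lp.single 2 t ξ : lp X 2) t') = S.U rfl (η ⊗ₜ[ℂ] ξ) := by
      rintro t' ht' rfl
      rw [lp.single_apply_self]
    rw [lp.single_apply_self, creationFun, dif_pos (by exact le_self_add)]
    exact key _ _ (by simp)
  · rw [lp.single_apply_ne _ _ _ hr, creationFun]
    split_ifs with h
    · rw [lp.single_apply_ne, TensorProduct.tmul_zero, map_zero]
      intro h'
      exact hr (by rw [← h', add_tsub_cancel_of_le h])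
    · rfl

/-- The tensor algebra `𝒜_X`: the norm-closed algebra of operators on the Fock space generated by
all creation operators (it contains the identity, as the creation operator of the vacuum). -/
def tensorAlgebra (S : SubproductSystem X) : Subalgebra ℂ (Fock X →L[ℂ] Fock X) :=
  (Algebra.adjoin ℂ {T | ∃ (s : ℕ × ℕ) (η : X s), T = S.creation η}).topologicalClosure

/-- The character space `ℳ(𝒜_X)`: the nonzero multiplicative linear functionals on `𝒜_X`, with the
weak-* topology. -/
abbrev charSpace (S : SubproductSystem X) : Set (WeakDual ℂ S.tensorAlgebra) :=
  WeakDual.characterSpace ℂ S.tensorAlgebra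

end SubproductSystem

/-! ### Standard subproduct systems -/

section Standard

variable (E : Type u) (F : Type v) [NormedAddCommGroup E] [InnerProductSpace ℂ E]
  [FiniteDimensional ℂ E] [NormedAddCommGroup F] [InnerProductSpace ℂ F] [FiniteDimensional ℂ F]

/-- A standard subproduct system `X` with `X(1,0) = E` and `X(0,1) = F`: the fibres are subspaces
`X(i,j) ⊆ E^{⊗ i} ⊗ F^{⊗ j}`, and for some unitary `u : F ⊗ E → E ⊗ F`, the coisometry `U_{s,t}` is
the restriction of `p_{s+t} W^u_{s,t}` to `X(s) ⊗ X(t)`, where `p_r` is the orthogonal projection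
onto `X(r)`. -/
structure StandardSubproductSystem where
  fiber : ∀ s : ℕ × ℕ, Submodule ℂ (BiPow E F s)
  fiber_one_zero : fiber (1, 0) = ⊤
  fiber_zero_one : fiber (0, 1) = ⊤
  sys : SubproductSystem (fun s => fiber s)
  exists_unitary : ∃ u : F ⊗[ℂ] E ≃ₗᵢ[ℂ] E ⊗[ℂ] F,
    ∀ (s t : ℕ × ℕ) (x : fiber s) (y : fiber t),
      sys.U (add_comm s t) (x ⊗ₜ[ℂ] y) =
        (fiber (t + s)).orthogonalProjectionOnto (mulW u s t ((x : BiPow E F s) ⊗ₜ[ℂ] (y : BiPow E F t)))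

namespace StandardSubproductSystem

variable {E F}

/-- A unitary `u : F ⊗ E → E ⊗ F` is a commutation relation for `X` if
`p_{(1,1)} u = (U_{(1,0),(0,1)})^* U_{(0,1),(1,0)}`. In a standard subproduct system
`U_{(1,0),(0,1)}` is the orthogonal projection of `E ⊗ F` onto `X(1,1)`, so that its adjoint is the
inclusion of `X(1,1)` in `E ⊗ F`. -/
def IsCommutationRelation (X : StandardSubproductSystem E F)
    (u : F ⊗[ℂ] E ≃ₗᵢ[ℂ] E ⊗[ℂ] F) : Prop :=
  ∀ (e : X.fiber (1, 0)) (f : X.fiber (0, 1)),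
    (X.fiber (1, 1)).orthogonalProjectionOnto
        (embEF E F (u ((embF E F).symm f ⊗ₜ[ℂ] (embE E F).symm e))) =
      X.sys.U (show ((0, 1) : ℕ × ℕ) + (1, 0) = (1, 1) from rfl) (f ⊗ₜ[ℂ] e)

end StandardSubproductSystem

end Standard

/-! ### Polynomials and polyball varieties -/

section Poly

variable {m n : ℕ}

/-- The polyball variety `Ω^{m,n}(I)` of a set `I` of polynomials in the variables
`z₁, …, z_m` (`Sum.inl`) and `w₁, …, w_n` (`Sum.inr`). -/
def polyballVariety (I : Set (MvPolynomial (Fin m ⊕ Fin n) ℂ)) :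
    Set (EuclideanSpace ℂ (Fin m) × EuclideanSpace ℂ (Fin n)) :=
  {a | (∀ p ∈ I, MvPolynomial.eval (Sum.elim a.1 a.2) p = 0) ∧ ‖a.1‖ ≤ 1 ∧ ‖a.2‖ ≤ 1}

/-- `p` is `(m,n)`-homogeneous of degree `(d, d')`: every monomial of `p` has degree `d` in the
`z`-variables and degree `d'` in the `w`-variables. -/
def IsBihomogeneous (p : MvPolynomial (Fin m ⊕ Fin n) ℂ) (d d' : ℕ) : Prop :=
  ∀ c ∈ p.support, ∑ i, c (Sum.inl i) = d ∧ ∑ j, c (Sum.inr j) = d'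

/-- An ideal is `(m,n)`-homogeneous if it is generated by `(m,n)`-homogeneous polynomials. -/
def IsBihomogeneousIdeal (J : Ideal (MvPolynomial (Fin m ⊕ Fin n) ℂ)) : Prop :=
  ∃ G : Set (MvPolynomial (Fin m ⊕ Fin n) ℂ),
    (∀ p ∈ G, ∃ d d' : ℕ, IsBihomogeneous p d d') ∧ J = Ideal.span G

variable {E : Type u} {F : Type v} [NormedAddCommGroup E] [InnerProductSpace ℂ E]
  [NormedAddCommGroup F] [InnerProductSpace ℂ F]

open MvPolynomial in
/-- `p_{i,j} = w_j z_i - ∑_{k,l} u_{(k,l),(i,j)} z_k w_l`, where `u_{(k,l),(i,j)}` is the coefficient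
of `e_k ⊗ f_l` in `u (f_j ⊗ e_i)`. -/
def commPoly (u : F ⊗[ℂ] E ≃ₗᵢ[ℂ] E ⊗[ℂ] F) (e : OrthonormalBasis (Fin m) ℂ E)
    (f : OrthonormalBasis (Fin n) ℂ F) (i : Fin m) (j : Fin n) :
    MvPolynomial (Fin m ⊕ Fin n) ℂ :=
  X (Sum.inr j) * X (Sum.inl i) -
    ∑ k, ∑ l, C (inner ℂ (e k ⊗ₜ[ℂ] f l) (u (f j ⊗ₜ[ℂ] e i))) * X (Sum.inl k) * X (Sum.inr l)

open MvPolynomial in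
/-- The polynomial `q^x` of `x ∈ E^{⊗ i} ⊗ F^{⊗ j}`, obtained by replacing each basis tensor
`e_{a₁} ⊗ ⋯ ⊗ e_{aᵢ} ⊗ f_{b₁} ⊗ ⋯ ⊗ f_{bⱼ}` by the monomial `z_{a₁} ⋯ z_{aᵢ} w_{b₁} ⋯ w_{bⱼ}`. -/
def tensorPoly (e : OrthonormalBasis (Fin m) ℂ E) (f : OrthonormalBasis (Fin n) ℂ F)
    (s : ℕ × ℕ) (x : BiPow E F s) : MvPolynomial (Fin m ⊕ Fin n) ℂ :=
  ∑ a : Fin s.1 → Fin m, ∑ b : Fin s.2 → Fin n,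
    C (inner ℂ (elemTensor s.1 (fun k => e (a k)) ⊗ₜ[ℂ] elemTensor s.2 (fun l => f (b l))) x) *
      ((∏ k, X (Sum.inl (a k))) * ∏ l, X (Sum.inr (b l)))

/-- The ideal generated by the polynomials `p_{i,j}` and all `q^x` with
`x ∈ E^{⊗ i} ⊗ F^{⊗ j} ⊖ X(i,j)`, `i, j ≥ 0`. -/
def charIdeal [FiniteDimensional ℂ E] [FiniteDimensional ℂ F] (X : StandardSubproductSystem E F)
    (u : F ⊗[ℂ] E ≃ₗᵢ[ℂ] E ⊗[ℂ] F) (e : OrthonormalBasis (Fin m) ℂ E)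
    (f : OrthonormalBasis (Fin n) ℂ F) : Ideal (MvPolynomial (Fin m ⊕ Fin n) ℂ) :=
  Ideal.span ({p | ∃ i j, p = commPoly u e f i j} ∪
    {q | ∃ (s : ℕ × ℕ) (x : BiPow E F s), x ∈ (X.fiber s)ᗮ ∧ q = tensorPoly e f s x})

end Poly

end

/-! A character `φ` is determined by its values on the creation operators. Composing `η ↦ φ(L_η)` on
`X(s)` with the projection `p_s` gives functionals on the full spaces `E^{⊗ i} ⊗ F^{⊗ j}`. The crux
is that these are multiplicative for `W^U`, where `U` is the unitary that defines the product of
`X`. This follows from `U_{s,t} (p_s ⊗ p_t) = p_{s+t} W^U`, which holds because a coisometry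
compressed from a unitary forces `X(s+t) ⊆ W^U (X(s) ⊗ X(t))` (`exists_eq_of_compression`,
`U_proj_tmul_proj`).

A multiplicative family is determined in degrees `(1,0)` and `(0,1)`, hence is the pairing with
`a^{⊗ i} ⊗ b^{⊗ j}`, where `a` and `b` represent `φ` on `E` and `F` (`eq_inner_biPowVec`). Vanishing
on `X(s)ᗮ` puts these vectors in the fibres, and multiplicativity on `F ⊗ E` says `U (b ⊗ a) = a ⊗
b`: `(a, b)` is a kernel point. Contractivity bounds both norms by 1.

Conversely, for a kernel point in the open polyball the vectors `a^{⊗ i} ⊗ b^{⊗ j}` are square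
summable, and `T ↦ ⟨k, T Ω⟩`, with `k` their sum, is a character (`exists_char`). Boundary points
are limits of these, and the image of the compact character space is closed.

Finally, `u` and `U` agree after projection to `X(1,1)`, which contains `a ⊗ b`, so either one gives
the same kernel points (`isKernelPoint_iff`). In coordinates, the kernel conditions are the
vanishing of the `q^x` and the `p_{i,j}`. -/

noncomputable section

/-! ### Powers of vectors and the product-system multiplication. -/

section TensorComputations

variable {E : Type u} {F : Type v} [NormedAddCommGroup E] [InnerProductSpace ℂ E]
  [NormedAddCommGroup F] [InnerProductSpace ℂ F]

/-- The tensor power `a^{⊗ n}`. -/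
def powVec (a : E) (n : ℕ) : TPow E n := elemTensor n fun _ => a

theorem powVec_zero (a : E) : powVec a 0 = (tpowZero E).symm 1 := rfl

theorem powVec_succ (a : E) (n : ℕ) :
    powVec a (n + 1) = (tpowSucc E n).symm (a ⊗ₜ[ℂ] powVec a n) := rfl

theorem norm_powVec (a : E) (n : ℕ) : ‖powVec a n‖ = ‖a‖ ^ n := by
  induction n with
  | zero => rw [powVec_zero, LinearIsometryEquiv.norm_map]; simp
  | succ n ih => rw [powVec_succ, LinearIsometryEquiv.norm_map, TensorProduct.norm_tmul, ih, pow_succ']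

theorem powVec_smul (c : ℂ) (a : E) (n : ℕ) : powVec (c • a) n = c ^ n • powVec a n := by
  induction n with
  | zero => simp [powVec_zero]
  | succ n ih =>
    rw [powVec_succ, powVec_succ, ih, TensorProduct.smul_tmul_smul, map_smul, pow_succ']

theorem tpowConcat_zero_tmul (k : ℕ) (c : ℂ) (x : TPow E k) :
    tpowConcat E 0 k ((tpowZero E).symm c ⊗ₜ[ℂ] x) = c • x := by
  simp [tpowConcat]

theorem tpowConcat_succ_tmul (i k : ℕ) (e : E) (x : TPow E i) (y : TPow E k) :
    tpowConcat E (i + 1) k ((tpowSucc E i).symm (e ⊗ₜ[ℂ] x) ⊗ₜ[ℂ] y) =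
      (tpowSucc E (k + i)).symm (e ⊗ₜ[ℂ] tpowConcat E i k (x ⊗ₜ[ℂ] y)) := by
  simp [tpowConcat]

theorem tpowOne_apply (e : E) : tpowOne E e = (tpowSucc E 0).symm (e ⊗ₜ[ℂ] (tpowZero E).symm 1) := by
  simp [tpowOne]

theorem embE_apply (e : E) : embE E F e = tpowOne E e ⊗ₜ[ℂ] (tpowZero F).symm 1 := by
  simp [embE]

theorem embF_apply (f : F) : embF E F f = (tpowZero E).symm 1 ⊗ₜ[ℂ] tpowOne F f := by
  simp [embF]

theorem embEF_tmul (e : E) (f : F) : embEF E F (e ⊗ₜ[ℂ] f) = tpowOne E e ⊗ₜ[ℂ] tpowOne F f := by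
  simp [embEF]

theorem commOne_zero_tmul (U : F ⊗[ℂ] E ≃ₗᵢ[ℂ] E ⊗[ℂ] F) (f : F) (c : ℂ) :
    commOne U 0 (f ⊗ₜ[ℂ] (tpowZero E).symm c) = (tpowZero E).symm c ⊗ₜ[ℂ] f := by
  simp [commOne]

theorem commMany_zero_tmul (U : F ⊗[ℂ] E ≃ₗᵢ[ℂ] E ⊗[ℂ] F) (n : ℕ) (c : ℂ) (x : TPow E n) :
    commMany U 0 n ((tpowZero F).symm c ⊗ₜ[ℂ] x) = x ⊗ₜ[ℂ] (tpowZero F).symm c := by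
  simp [commMany]

/-- Each application of `U` meets a factor `b ⊗ a` and merely flips it. -/
theorem commOne_powVec {U : F ⊗[ℂ] E ≃ₗᵢ[ℂ] E ⊗[ℂ] F} {a : E} {b : F}
    (h : U (b ⊗ₜ[ℂ] a) = a ⊗ₜ[ℂ] b) (n : ℕ) :
    commOne U n (b ⊗ₜ[ℂ] powVec a n) = powVec a n ⊗ₜ[ℂ] b := by
  induction n with
  | zero => rw [powVec_zero, commOne_zero_tmul]
  | succ n ih => simp [commOne, powVec_succ, h, ih]

theorem commMany_powVec {U : F ⊗[ℂ] E ≃ₗᵢ[ℂ] E ⊗[ℂ] F} {a : E} {b : F}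
    (h : U (b ⊗ₜ[ℂ] a) = a ⊗ₜ[ℂ] b) (m n : ℕ) :
    commMany U m n (powVec b m ⊗ₜ[ℂ] powVec a n) = powVec a n ⊗ₜ[ℂ] powVec b m := by
  induction m with
  | zero => rw [powVec_zero, commMany_zero_tmul]
  | succ m ih => simp [commMany, powVec_succ b, commOne_powVec h, ih]

theorem tpowConcat_powVec (a : E) (i k : ℕ) :
    tpowConcat E i k (powVec a i ⊗ₜ[ℂ] powVec a k) = powVec a (k + i) := by
  induction i with
  | zero => rw [powVec_zero, tpowConcat_zero_tmul, one_smul]; rfl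
  | succ i ih => rw [powVec_succ, tpowConcat_succ_tmul, ih]; rfl

/-- The vector `a^{⊗ i} ⊗ b^{⊗ j}`. -/
def biPowVec (a : E) (b : F) (s : ℕ × ℕ) : BiPow E F s := powVec a s.1 ⊗ₜ[ℂ] powVec b s.2

theorem norm_biPowVec (a : E) (b : F) (s : ℕ × ℕ) :
    ‖biPowVec a b s‖ = ‖a‖ ^ s.1 * ‖b‖ ^ s.2 := by
  rw [biPowVec, TensorProduct.norm_tmul, norm_powVec, norm_powVec]

theorem biPowVec_smul (c : ℂ) (a : E) (b : F) (s : ℕ × ℕ) :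
    biPowVec (c • a) (c • b) s = (c ^ s.1 * c ^ s.2) • biPowVec a b s := by
  rw [biPowVec, powVec_smul, powVec_smul, TensorProduct.smul_tmul_smul]; rfl

/-- The image of an elementary tensor need not be elementary, since `U` may entangle the factors;
`h` isolates the case where it is. -/
theorem mulW_tmul (U : F ⊗[ℂ] E ≃ₗᵢ[ℂ] E ⊗[ℂ] F) (s t : ℕ × ℕ) (x : TPow E s.1) (y : TPow F s.2)
    (x' : TPow E t.1) (y' : TPow F t.2) (x'' : TPow E t.1) (y'' : TPow F s.2)
    (h : commMany U s.2 t.1 (y ⊗ₜ[ℂ] x') = x'' ⊗ₜ[ℂ] y'') :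
    mulW U s t ((x ⊗ₜ[ℂ] y) ⊗ₜ[ℂ] (x' ⊗ₜ[ℂ] y')) =
      tpowConcat E s.1 t.1 (x ⊗ₜ[ℂ] x'') ⊗ₜ[ℂ] tpowConcat F s.2 t.2 (y'' ⊗ₜ[ℂ] y') := by
  simp [mulW, h]

theorem mulW_biPowVec {U : F ⊗[ℂ] E ≃ₗᵢ[ℂ] E ⊗[ℂ] F} {a : E} {b : F}
    (h : U (b ⊗ₜ[ℂ] a) = a ⊗ₜ[ℂ] b) (s t : ℕ × ℕ) :
    mulW U s t (biPowVec a b s ⊗ₜ[ℂ] biPowVec a b t) = biPowVec a b (t + s) := by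
  rw [biPowVec, biPowVec, mulW_tmul _ _ _ _ _ _ _ _ _ (commMany_powVec h _ _), tpowConcat_powVec,
    tpowConcat_powVec]
  rfl

theorem inner_biPowVec_mulW {U : F ⊗[ℂ] E ≃ₗᵢ[ℂ] E ⊗[ℂ] F} {a : E} {b : F}
    (h : U (b ⊗ₜ[ℂ] a) = a ⊗ₜ[ℂ] b) (s t : ℕ × ℕ) (x : BiPow E F s) (y : BiPow E F t) :
    inner ℂ (biPowVec a b (t + s)) (mulW U s t (x ⊗ₜ[ℂ] y)) =
      inner ℂ (biPowVec a b s) x * inner ℂ (biPowVec a b t) y := by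
  rw [← mulW_biPowVec h]
  exact ((mulW U s t).inner_map_map _ _).trans (TensorProduct.inner_tmul (𝕜 := ℂ) ..)

theorem mulW_vacuum_left (U : F ⊗[ℂ] E ≃ₗᵢ[ℂ] E ⊗[ℂ] F) (t : ℕ × ℕ) (x : TPow E t.1)
    (y : TPow F t.2) :
    mulW U 0 t (((tpowZero E).symm 1 ⊗ₜ[ℂ] (tpowZero F).symm 1) ⊗ₜ[ℂ] (x ⊗ₜ[ℂ] y)) =
      x ⊗ₜ[ℂ] y := by
  refine (mulW_tmul U 0 t _ _ _ _ _ _ (commMany_zero_tmul U t.1 1 x)).trans ?_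
  erw [tpowConcat_zero_tmul, tpowConcat_zero_tmul]
  rw [one_smul, one_smul]

/-- A factor from `E` on the left crosses nothing, so `U` plays no part; this permits induction on
`i` in `eq_inner_biPowVec`. The next lemma does the same for `F` once no factor from `E` remains. -/
theorem mulW_embE_tmul (U : F ⊗[ℂ] E ≃ₗᵢ[ℂ] E ⊗[ℂ] F) (i j : ℕ) (e : E) (x : TPow E i)
    (y : TPow F j) :
    mulW U (1, 0) (i, j) (embE E F e ⊗ₜ[ℂ] (x ⊗ₜ[ℂ] y)) =
      ((tpowSucc E i).symm (e ⊗ₜ[ℂ] x) ⊗ₜ[ℂ] y : BiPow E F (i + 1, j)) := by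
  rw [embE_apply]
  refine (mulW_tmul U (1, 0) (i, j) _ _ _ _ _ _ (commMany_zero_tmul U i 1 x)).trans ?_
  rw [tpowOne_apply]
  erw [tpowConcat_zero_tmul, tpowConcat_succ_tmul, tpowConcat_zero_tmul]
  rw [one_smul, one_smul]
  rfl

theorem mulW_embF_tmul (U : F ⊗[ℂ] E ≃ₗᵢ[ℂ] E ⊗[ℂ] F) (j : ℕ) (f : F) (c : ℂ) (y : TPow F j) :
    mulW U (0, 1) (0, j) (embF E F f ⊗ₜ[ℂ] ((tpowZero E).symm c ⊗ₜ[ℂ] y)) =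
      ((tpowZero E).symm c ⊗ₜ[ℂ] (tpowSucc F j).symm (f ⊗ₜ[ℂ] y) : BiPow E F (0, j + 1)) := by
  have h : commMany U 1 0 (tpowOne F f ⊗ₜ[ℂ] (tpowZero E).symm c) =
      (tpowZero E).symm c ⊗ₜ[ℂ] tpowOne F f := by
    simp [commMany, tpowOne_apply, commOne_zero_tmul]
  rw [embF_apply]
  refine (mulW_tmul U (0, 1) (0, j) _ _ _ _ _ _ h).trans ?_
  rw [tpowOne_apply]
  erw [tpowConcat_zero_tmul, tpowConcat_succ_tmul, tpowConcat_zero_tmul]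
  rw [one_smul, one_smul]
  rfl

theorem commOne_one_tmul (U : F ⊗[ℂ] E ≃ₗᵢ[ℂ] E ⊗[ℂ] F) (e : E) (f : F) :
    commOne U 1 (f ⊗ₜ[ℂ] tpowOne E e) = (tpowOne E).rTensor F (U (f ⊗ₜ[ℂ] e)) := by
  simp only [commOne, tpowOne_apply]
  simp
  generalize U (f ⊗ₜ[ℂ] e) = z
  induction z with
  | zero => simp
  | add x y hx hy => simp only [map_add, TensorProduct.add_tmul, hx, hy]
  | tmul x y => simp [tpowOne_apply]

theorem commMany_one_one_tmul (U : F ⊗[ℂ] E ≃ₗᵢ[ℂ] E ⊗[ℂ] F) (e : E) (f : F) :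
    commMany U 1 1 (tpowOne F f ⊗ₜ[ℂ] tpowOne E e) = embEF E F (U (f ⊗ₜ[ℂ] e)) := by
  simp only [commMany, tpowOne_apply f]
  simp [commOne_one_tmul]
  generalize U (f ⊗ₜ[ℂ] e) = z
  induction z with
  | zero => simp
  | add x y hx hy => simp only [map_add, TensorProduct.add_tmul, hx, hy]
  | tmul x y => simp [embEF_tmul, tpowOne_apply (E := F)]

/-- The lowest degree in which `U` is visible in the multiplication; the flip condition and the
commutation relation are read off here. -/
theorem mulW_embF_embE (U : F ⊗[ℂ] E ≃ₗᵢ[ℂ] E ⊗[ℂ] F) (e : E) (f : F) :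
    mulW U (0, 1) (1, 0) (embF E F f ⊗ₜ[ℂ] embE E F e) = embEF E F (U (f ⊗ₜ[ℂ] e)) := by
  simp only [mulW, embF_apply, embE_apply]
  simp [commMany_one_one_tmul]
  generalize U (f ⊗ₜ[ℂ] e) = z
  induction z with
  | zero => simp
  | add x y hx hy => simp only [map_add, TensorProduct.add_tmul, TensorProduct.tmul_add, hx, hy]
  | tmul x y =>
    simp [embEF_tmul, tpowConcat_zero_tmul]
    rw [tpowOne_apply (E := F), tpowConcat_succ_tmul, tpowConcat_zero_tmul, one_smul]

theorem exists_eq_smul_vacuum (x : TPow E 0 ⊗[ℂ] TPow F 0) :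
    ∃ c : ℂ, x = c • ((tpowZero E).symm 1 ⊗ₜ[ℂ] (tpowZero F).symm 1) := by
  induction x with
  | zero => exact ⟨0, (zero_smul ℂ _).symm⟩
  | add x y hx hy =>
    obtain ⟨c, rfl⟩ := hx
    obtain ⟨d, rfl⟩ := hy
    exact ⟨c + d, (add_smul c d _).symm⟩
  | tmul x y =>
    refine ⟨tpowZero E x * tpowZero F y, ?_⟩
    rw [← TensorProduct.smul_tmul_smul, ← map_smul, ← map_smul]
    simp

theorem biPowVec_one_zero (a : E) (b : F) : biPowVec a b (1, 0) = embE E F a := by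
  rw [embE_apply, tpowOne_apply]; rfl

theorem biPowVec_zero_one (a : E) (b : F) : biPowVec a b (0, 1) = embF E F b := by
  rw [embF_apply, tpowOne_apply]; rfl

theorem biPowVec_one_one (a : E) (b : F) : biPowVec a b (1, 1) = embEF E F (a ⊗ₜ[ℂ] b) := by
  rw [embEF_tmul, tpowOne_apply, tpowOne_apply]; rfl

/-- A family of functionals which is multiplicative for the operators `W^U` is given by the
vectors `a^{⊗ i} ⊗ b^{⊗ j}`, where `a` and `b` represent the functionals on `E` and `F`. -/
theorem eq_inner_biPowVec (U : F ⊗[ℂ] E ≃ₗᵢ[ℂ] E ⊗[ℂ] F)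
    (Ψ : ∀ s : ℕ × ℕ, BiPow E F s →ₗ[ℂ] ℂ) {a : E} {b : F}
    (h0 : Ψ (0, 0) ((tpowZero E).symm 1 ⊗ₜ[ℂ] (tpowZero F).symm 1) = 1)
    (hmul : ∀ (s t : ℕ × ℕ) (x : BiPow E F s) (y : BiPow E F t),
      Ψ (t + s) (mulW U s t (x ⊗ₜ[ℂ] y)) = Ψ s x * Ψ t y)
    (ha : ∀ e, Ψ (1, 0) (embE E F e) = inner ℂ a e)
    (hb : ∀ f, Ψ (0, 1) (embF E F f) = inner ℂ b f) (s : ℕ × ℕ) (x : BiPow E F s) :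
    Ψ s x = inner ℂ (biPowVec a b s) x := by
  -- Factors from `E` are peeled off first and those from `F` only at `i = 0`, so that no
  -- commutation is needed.
  have key : ∀ (i j : ℕ) (x : TPow E i) (y : TPow F j),
      Ψ (i, j) (x ⊗ₜ[ℂ] y) = inner ℂ (powVec a i) x * inner ℂ (powVec b j) y := by
    intro i
    induction i with
    | zero =>
      intro j
      induction j with
      | zero =>
        intro x y
        obtain ⟨c, rfl⟩ := (tpowZero E).symm.surjective x
        obtain ⟨d, rfl⟩ := (tpowZero F).symm.surjective y
        rw [← mul_one c, ← mul_one d, ← smul_eq_mul, ← smul_eq_mul, map_smul, map_smul,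
          TensorProduct.smul_tmul_smul, map_smul]
        refine (congrArg _ h0).trans ?_
        rw [inner_smul_right, inner_smul_right, powVec_zero, powVec_zero,
          LinearIsometryEquiv.inner_map_map, LinearIsometryEquiv.inner_map_map]
        simp
      | succ j ih =>
        intro x y
        obtain ⟨c, rfl⟩ := (tpowZero E).symm.surjective x
        obtain ⟨y, rfl⟩ := (tpowSucc F j).symm.surjective y
        induction y with
        | zero => simp
        | add y y' hy hy' =>
          rw [map_add, TensorProduct.tmul_add, map_add, hy, hy', inner_add_right, mul_add]
        | tmul f y =>
          rw [← mulW_embF_tmul U]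
          refine (hmul (0, 1) (0, j) _ _).trans ?_
          rw [hb, ih, powVec_succ, LinearIsometryEquiv.inner_map_map, TensorProduct.inner_tmul]
          ring
    | succ i ih =>
      intro j x y
      obtain ⟨x, rfl⟩ := (tpowSucc E i).symm.surjective x
      induction x with
      | zero => simp
      | add x x' hx hx' =>
        rw [map_add, TensorProduct.add_tmul, map_add, hx, hx', inner_add_right, add_mul]
      | tmul e x =>
        rw [← mulW_embE_tmul U]
        refine (hmul (1, 0) (i, j) _ _).trans ?_
        rw [ha, ih, powVec_succ, LinearIsometryEquiv.inner_map_map, TensorProduct.inner_tmul]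
        ring
  have h : Ψ s = (innerSL ℂ (biPowVec a b s) : BiPow E F s →ₗ[ℂ] ℂ) :=
    TensorProduct.ext' fun x y => (key s.1 s.2 x y).trans
      (TensorProduct.inner_tmul (𝕜 := ℂ) ..).symm
  exact LinearMap.congr_fun h x

/-- The pairings determine `V.symm (a ⊗ b)`, as `V` is unitary. In this form the condition depends
on `V` only through its pairings with `a ⊗ b`. -/
theorem flip_iff_inner (V : F ⊗[ℂ] E ≃ₗᵢ[ℂ] E ⊗[ℂ] F) (a : E) (b : F) :
    V (b ⊗ₜ[ℂ] a) = a ⊗ₜ[ℂ] b ↔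
      ∀ e f, inner ℂ (a ⊗ₜ[ℂ] b) (V (f ⊗ₜ[ℂ] e)) = inner ℂ b f * inner ℂ a e := by
  constructor
  · intro h e f
    rw [← h, LinearIsometryEquiv.inner_map_map, TensorProduct.inner_tmul]
  · intro h
    have h1 : V.symm (a ⊗ₜ[ℂ] b) = b ⊗ₜ[ℂ] a := by
      refine TensorProduct.ext_iff_inner_right.2 fun f e => ?_
      rw [TensorProduct.inner_tmul, ← h, ← V.inner_map_map, V.apply_symm_apply]
    rw [← h1, V.apply_symm_apply]

end TensorComputations

/-! ### Creation operators and the tensor algebra. -/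

namespace SubproductSystem

theorem clm_ext_single {X : ℕ × ℕ → Type w} [∀ s, NormedAddCommGroup (X s)]
    [∀ s, InnerProductSpace ℂ (X s)] {V : Type*} [NormedAddCommGroup V] [NormedSpace ℂ V]
    {A B : Fock X →L[ℂ] V} (h : ∀ t (ξ : X t), A (lp.single 2 t ξ) = B (lp.single 2 t ξ)) :
    A = B := by
  ext ξ
  have h1 := (lp.hasSum_single (p := 2) (by norm_num) ξ)
  refine (h1.mapL A).unique ?_
  simpa only [h] using h1.mapL B

variable {X : ℕ × ℕ → Type w} [∀ s, NormedAddCommGroup (X s)]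
    [∀ s, InnerProductSpace ℂ (X s)] [∀ s, FiniteDimensional ℂ (X s)]

theorem creation_apply (S : SubproductSystem X) {s : ℕ × ℕ} (η : X s) (ξ : Fock X) (r : ℕ × ℕ) :
    S.creation η ξ r = S.creationFun η ξ r := rfl

theorem norm_creation_le (S : SubproductSystem X) {s : ℕ × ℕ} (η : X s) :
    ‖S.creation η‖ ≤ ‖η‖ :=
  LinearMap.mkContinuous_norm_le _ (norm_nonneg η) _

theorem creation_vac (S : SubproductSystem X) : S.creation S.vac = 1 := by
  ext ξ r
  have key : ∀ (t : ℕ × ℕ) (h : 0 + t = r), t = r → S.U h (S.vac ⊗ₜ[ℂ] ξ t) = ξ r := by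
    rintro t h rfl
    exact S.vac_mul _ _
  rw [creation_apply, creationFun, dif_pos (zero_le (a := r))]
  exact key _ _ (tsub_zero r)

theorem creation_mul_creation (S : SubproductSystem X) {s t r : ℕ × ℕ} (h : s + t = r) (η : X s)
    (ζ : X t) : S.creation η * S.creation ζ = S.creation (S.U h (η ⊗ₜ[ℂ] ζ)) := by
  refine clm_ext_single fun q ξ => ?_
  rw [mul_apply_eq_comp, S.creation_single rfl, S.creation_single rfl,
    S.creation_single (r := s + (t + q)) (by rw [← h, add_assoc]), S.assoc]

theorem creation_add (S : SubproductSystem X) {s : ℕ × ℕ} (η ζ : X s) :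
    S.creation (η + ζ) = S.creation η + S.creation ζ := by
  refine clm_ext_single fun q ξ => ?_
  rw [add_apply, S.creation_single rfl, S.creation_single rfl, S.creation_single rfl,
    TensorProduct.add_tmul, map_add, lp.single_add]

theorem creation_smul (S : SubproductSystem X) {s : ℕ × ℕ} (c : ℂ) (η : X s) :
    S.creation (c • η) = c • S.creation η := by
  refine clm_ext_single fun q ξ => ?_
  rw [smul_apply, S.creation_single rfl, S.creation_single rfl,
    ← TensorProduct.smul_tmul', map_smul, lp.single_smul]

/-- The creation operator of `η`, as an element of the tensor algebra. -/
def gen (S : SubproductSystem X) (s : ℕ × ℕ) : X s →ₗ[ℂ] S.tensorAlgebra where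
  toFun η := ⟨S.creation η, Subalgebra.le_topologicalClosure _ (Algebra.subset_adjoin ⟨s, η, rfl⟩)⟩
  map_add' η ζ := Subtype.ext (S.creation_add η ζ)
  map_smul' c η := Subtype.ext (S.creation_smul c η)

theorem norm_gen_le (S : SubproductSystem X) (s : ℕ × ℕ) (η : X s) : ‖S.gen s η‖ ≤ ‖η‖ :=
  S.norm_creation_le η

theorem gen_vac (S : SubproductSystem X) : S.gen 0 S.vac = 1 := Subtype.ext S.creation_vac

theorem gen_mul_gen (S : SubproductSystem X) {s t r : ℕ × ℕ} (h : s + t = r) (η : X s) (ζ : X t) :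
    S.gen s η * S.gen t ζ = S.gen r (S.U h (η ⊗ₜ[ℂ] ζ)) :=
  Subtype.ext (S.creation_mul_creation h η ζ)

/-- Creation operators already form a monoid: the vacuum gives the unit, and associativity of the
maps `U_{s,t}` gives the products. -/
theorem adjoin_creation_toSubmodule (S : SubproductSystem X) :
    Subalgebra.toSubmodule (Algebra.adjoin ℂ {T | ∃ (s : ℕ × ℕ) (η : X s), T = S.creation η}) =
      Submodule.span ℂ {T | ∃ (s : ℕ × ℕ) (η : X s), T = S.creation η} := by
  let M : Submonoid (Fock X →L[ℂ] Fock X) :=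
    { carrier := {T | ∃ (s : ℕ × ℕ) (η : X s), T = S.creation η}
      one_mem' := ⟨0, S.vac, S.creation_vac.symm⟩
      mul_mem' := by
        rintro _ _ ⟨s, η, rfl⟩ ⟨t, ζ, rfl⟩
        exact ⟨_, _, S.creation_mul_creation rfl η ζ⟩ }
  rw [Algebra.adjoin_eq_span]
  congr 1
  exact congrArg SetLike.coe (Submonoid.closure_eq M)

theorem dense_span_gen (S : SubproductSystem X) :
    Dense (Submodule.span ℂ {T : S.tensorAlgebra | ∃ (s : ℕ × ℕ) (η : X s), T = S.gen s η} :
      Set S.tensorAlgebra) := by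
  have h : (Subtype.val : S.tensorAlgebra → _) '' (Submodule.span ℂ
      {T : S.tensorAlgebra | ∃ (s : ℕ × ℕ) (η : X s), T = S.gen s η} : Set S.tensorAlgebra) =
      (Algebra.adjoin ℂ {T | ∃ (s : ℕ × ℕ) (η : X s), T = S.creation η} : Set _) := by
    have h2 := congrArg (SetLike.coe) S.adjoin_creation_toSubmodule
    rw [Subalgebra.coe_toSubmodule] at h2
    rw [h2]
    have h3 := Submodule.map_coe S.tensorAlgebra.val.toLinearMap (Submodule.span ℂ
      {T : S.tensorAlgebra | ∃ (s : ℕ × ℕ) (η : X s), T = S.gen s η})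
    refine h3.symm.trans (congrArg SetLike.coe ?_)
    rw [Submodule.map_span]
    congr 1
    ext T
    constructor
    · rintro ⟨_, ⟨s, η, rfl⟩, rfl⟩
      exact ⟨s, η, rfl⟩
    · rintro ⟨s, η, rfl⟩
      exact ⟨_, ⟨s, η, rfl⟩, rfl⟩
  rw [Subtype.dense_iff]
  intro T hT
  erw [h]
  exact hT

theorem clm_ext_gen (S : SubproductSystem X) {f g : S.tensorAlgebra →L[ℂ] ℂ}
    (h : ∀ s (η : X s), f (S.gen s η) = g (S.gen s η)) : f = g := by
  refine ContinuousLinearMap.ext_on S.dense_span_gen ?_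
  rintro _ ⟨s, η, rfl⟩
  exact h s η

/-- Completeness makes the tensor algebra a Banach algebra, whence the boundedness of characters and
the compactness of the character space. -/
instance (S : SubproductSystem X) : CompleteSpace S.tensorAlgebra := by
  have : ∀ s, CompleteSpace (X s) := fun s => FiniteDimensional.complete ℂ (X s)
  exact (Subalgebra.isClosed_topologicalClosure _).completeSpace_coe

instance compactSpace_charSpace (S : SubproductSystem X) : CompactSpace S.charSpace :=
  inferInstance

theorem norm_char_apply_le (S : SubproductSystem X) (φ : S.charSpace) (T : S.tensorAlgebra) :
    ‖φ T‖ ≤ ‖T‖ := by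
  have h1 := WeakDual.CharacterSpace.norm_le_norm_one φ
  have h2 : ‖(1 : S.tensorAlgebra)‖ ≤ 1 := ContinuousLinearMap.norm_id_le
  refine (ContinuousLinearMap.le_opNorm (WeakDual.toStrongDual (φ : WeakDual ℂ S.tensorAlgebra)) T).trans ?_
  exact mul_le_of_le_one_left (norm_nonneg T) (h1.trans h2)

/-- A continuous linear functional on the tensor algebra that is unital and multiplicative on
creation operators is a character. -/
theorem mem_charSpace_of_gen (S : SubproductSystem X) (φ : S.tensorAlgebra →L[ℂ] ℂ)
    (h1 : φ 1 = 1)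
    (h : ∀ s t (η : X s) (ζ : X t), φ (S.gen s η * S.gen t ζ) = φ (S.gen s η) * φ (S.gen t ζ)) :
    StrongDual.toWeakDual φ ∈ S.charSpace := by
  -- Multiplicativity is extended by density one variable at a time, the right factor first.
  have h2 : ∀ s (η : X s) (T : S.tensorAlgebra), φ (S.gen s η * T) = φ (S.gen s η) * φ T := by
    intro s η T
    have : φ.comp (ContinuousLinearMap.mul ℂ S.tensorAlgebra (S.gen s η)) = φ (S.gen s η) • φ :=
      S.clm_ext_gen fun t ζ => h s t η ζ
    exact DFunLike.congr_fun this T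
  refine ⟨fun h0 => ?_, fun T T' => ?_⟩
  · have h3 : φ 1 = 0 := DFunLike.congr_fun h0 (1 : S.tensorAlgebra)
    exact one_ne_zero (h1.symm.trans h3)
  · have : φ.comp ((ContinuousLinearMap.mul ℂ S.tensorAlgebra).flip T') = φ T' • φ :=
      S.clm_ext_gen fun t ζ => (h2 t ζ T').trans (mul_comm _ _)
    exact (DFunLike.congr_fun this T).trans (mul_comm _ _)

end SubproductSystem

/-! ### Coisometries that are compressions of unitaries. -/

section Compression

variable {H : ℕ × ℕ → Type w} [∀ s, NormedAddCommGroup (H s)] [∀ s, InnerProductSpace ℂ (H s)]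
  [∀ s, FiniteDimensional ℂ (H s)] {fib : ∀ s, Submodule ℂ (H s)}

/-- Put `v = U_{s,t}^* z`. The coisometry property gives `‖v‖ = ‖z‖` and `U_{s,t} v = z`, so `W v`
has the norm of its projection `z` and must equal it. -/
theorem SubproductSystem.exists_eq_of_compression (S : SubproductSystem (fun s => fib s))
    {s t r : ℕ × ℕ} (h : s + t = r) (W : H s ⊗[ℂ] H t ≃ₗᵢ[ℂ] H r)
    (hW : ∀ (x : fib s) (y : fib t),
      S.U h (x ⊗ₜ[ℂ] y) = (fib r).orthogonalProjectionOnto (W ((x : H s) ⊗ₜ[ℂ] (y : H t))))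
    (z : fib r) :
    ∃ v : fib s ⊗[ℂ] fib t, (z : H r) = W (TensorProduct.mapInclIsometry (fib s) (fib t) v) := by
  have hW' (v : fib s ⊗[ℂ] fib t) : S.U h v = (fib r).orthogonalProjectionOnto
      (W (TensorProduct.mapInclIsometry (fib s) (fib t) v)) := by
    induction v with
    | zero => simp
    | add v w hv hw => simp only [map_add, hv, hw]
    | tmul x y => rw [hW]; rfl
  have hadj := LinearMap.congr_fun (S.coisometry h) z
  rw [LinearMap.comp_apply, LinearMap.id_apply] at hadj
  refine ⟨LinearMap.adjoint (S.U h) z, ?_⟩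
  have hnorm : inner ℂ (LinearMap.adjoint (S.U h) z) (LinearMap.adjoint (S.U h) z) =
      inner ℂ z z := by
    rw [LinearMap.adjoint_inner_left, hadj]
  generalize LinearMap.adjoint (S.U h) z = v at hadj hnorm
  rw [hW'] at hadj
  set y := W (TensorProduct.mapInclIsometry (fib s) (fib t) v) with hy
  have hyy : inner ℂ y y = inner ℂ z z := by
    rw [hy, LinearIsometryEquiv.inner_map_map]
    exact (LinearIsometry.inner_map_map _ _ _).trans hnorm
  have hzy : inner ℂ (z : H r) y = inner ℂ z z := by
    rw [← Submodule.inner_orthogonalProjectionOnto_eq_of_mem_left, hadj]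
  have hyz : inner ℂ y (z : H r) = inner ℂ z z := by
    rw [← inner_conj_symm, hzy, inner_conj_symm]
  rw [← sub_eq_zero, ← inner_self_eq_zero (𝕜 := ℂ), inner_sub_left, inner_sub_right,
    inner_sub_right, hyy, hzy, hyz, ← Submodule.coe_inner]
  ring

/-- If `U_{s,t}` is the compression of a unitary `W`, then `U_{s,t} (p_s ⊗ p_t) = p_{s+t} W`. -/
theorem SubproductSystem.U_proj_tmul_proj (S : SubproductSystem (fun s => fib s))
    {s t r : ℕ × ℕ} (h : s + t = r) (W : H s ⊗[ℂ] H t ≃ₗᵢ[ℂ] H r)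
    (hW : ∀ (x : fib s) (y : fib t),
      S.U h (x ⊗ₜ[ℂ] y) = (fib r).orthogonalProjectionOnto (W ((x : H s) ⊗ₜ[ℂ] (y : H t))))
    (x : H s) (y : H t) :
    S.U h ((fib s).orthogonalProjectionOnto x ⊗ₜ[ℂ] (fib t).orthogonalProjectionOnto y) =
      (fib r).orthogonalProjectionOnto (W (x ⊗ₜ[ℂ] y)) := by
  rw [hW]
  refine ext_inner_left ℂ fun z => ?_
  rw [Submodule.inner_orthogonalProjectionOnto_eq_of_mem_left,
    Submodule.inner_orthogonalProjectionOnto_eq_of_mem_left]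
  -- Every test vector `z` is `W v` with `v` in the tensor product of the fibres, and pairing with
  -- `v` does not see the projections of `x` and `y`.
  obtain ⟨v, hv⟩ := S.exists_eq_of_compression h W hW z
  rw [hv, LinearIsometryEquiv.inner_map_map, LinearIsometryEquiv.inner_map_map]
  clear hv
  induction v with
  | zero => simp
  | add v w hv hw => rw [map_add, inner_add_left, inner_add_left, hv, hw]
  | tmul ξ η =>
    rw [TensorProduct.mapInclIsometry_apply, TensorProduct.mapIncl, TensorProduct.map_tmul,
      TensorProduct.inner_tmul, TensorProduct.inner_tmul, Submodule.subtype_apply,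
      Submodule.subtype_apply, ← Submodule.inner_orthogonalProjectionOnto_eq_of_mem_left ξ x,
      ← Submodule.inner_orthogonalProjectionOnto_eq_of_mem_left η y]
    rfl

/-- The norm alone would leave a phase undetermined when `o` is a unit vector. Since the vacuum is
idempotent, `c • vac = vac`, so `c = 1`. -/
theorem SubproductSystem.coe_vac_eq (S : SubproductSystem (fun s => fib s))
    (W : H 0 ⊗[ℂ] H 0 ≃ₗᵢ[ℂ] H 0)
    (hW : ∀ (x y : fib 0), S.U (zero_add 0) (x ⊗ₜ[ℂ] y) =
      (fib 0).orthogonalProjectionOnto (W ((x : H 0) ⊗ₜ[ℂ] (y : H 0))))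
    {o : H 0} (ho : W (o ⊗ₜ[ℂ] o) = o) {c : ℂ} (hc : (S.vac : H 0) = c • o) :
    (S.vac : H 0) = o := by
  have hvac : S.vac ≠ 0 := by
    intro h
    have := S.norm_vac
    rw [h, norm_zero] at this
    exact zero_ne_one this
  have h1 : S.vac = c • S.vac := by
    conv_lhs => rw [← S.vac_mul 0 S.vac, hW, hc, TensorProduct.smul_tmul_smul, map_smul, ho,
      mul_smul, ← hc, map_smul, Submodule.orthogonalProjectionOnto_mem_subspace_eq_self]
  have h2 : (1 - c) • S.vac = 0 := by rw [sub_smul, one_smul, ← h1, sub_self]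
  rcases smul_eq_zero.1 h2 with h3 | h3
  · rw [hc, ← sub_eq_zero.1 h3, one_smul]
  · exact absurd h3 hvac

end Compression

/-! ### The unitary behind a standard subproduct system. -/

namespace StandardSubproductSystem

variable {E : Type u} {F : Type v} [NormedAddCommGroup E] [InnerProductSpace ℂ E]
  [FiniteDimensional ℂ E] [NormedAddCommGroup F] [InnerProductSpace ℂ F] [FiniteDimensional ℂ F]

/-- The orthogonal projection onto the fibre `X(s)`. -/
abbrev proj (X : StandardSubproductSystem E F) (s : ℕ × ℕ) : BiPow E F s →L[ℂ] X.fiber s :=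
  (X.fiber s).orthogonalProjectionOnto

/-- `U` is a unitary which induces the multiplication of `X`. -/
def IsStructureUnitary (X : StandardSubproductSystem E F)
    (U : F ⊗[ℂ] E ≃ₗᵢ[ℂ] E ⊗[ℂ] F) : Prop :=
  ∀ (s t : ℕ × ℕ) (x : X.fiber s) (y : X.fiber t),
    X.sys.U (add_comm s t) (x ⊗ₜ[ℂ] y) =
      X.proj (t + s) (mulW U s t ((x : BiPow E F s) ⊗ₜ[ℂ] (y : BiPow E F t)))

variable {X : StandardSubproductSystem E F} {U : F ⊗[ℂ] E ≃ₗᵢ[ℂ] E ⊗[ℂ] F}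

/-- The multiplication of `X` is the compression of the multiplication of the product system. -/
theorem IsStructureUnitary.apply_proj (hU : X.IsStructureUnitary U) (s t : ℕ × ℕ)
    (x : BiPow E F s) (y : BiPow E F t) :
    X.sys.U (add_comm s t) (X.proj s x ⊗ₜ[ℂ] X.proj t y) =
      X.proj (t + s) (mulW U s t (x ⊗ₜ[ℂ] y)) :=
  SubproductSystem.U_proj_tmul_proj (H := BiPow E F) (fib := X.fiber) X.sys (add_comm s t)
    (mulW U s t) (hU s t) x y

theorem IsStructureUnitary.coe_vac (hU : X.IsStructureUnitary U) :
    (X.sys.vac : BiPow E F (0, 0)) = (tpowZero E).symm 1 ⊗ₜ[ℂ] (tpowZero F).symm 1 := by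
  obtain ⟨c, hc⟩ := exists_eq_smul_vacuum (X.sys.vac : BiPow E F (0, 0))
  exact SubproductSystem.coe_vac_eq (H := BiPow E F) (fib := X.fiber) X.sys (mulW U 0 0) (hU 0 0)
    (mulW_vacuum_left U 0 _ _) hc

theorem IsStructureUnitary.proj_vacuum (hU : X.IsStructureUnitary U) :
    X.proj (0, 0) ((tpowZero E).symm 1 ⊗ₜ[ℂ] (tpowZero F).symm 1) = X.sys.vac := by
  rw [← hU.coe_vac]
  exact Submodule.orthogonalProjectionOnto_mem_subspace_eq_self _

end StandardSubproductSystem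

/-! ### Vacuum functionals and characters. -/

namespace SubproductSystem

variable {X : ℕ × ℕ → Type w} [∀ s, NormedAddCommGroup (X s)]
    [∀ s, InnerProductSpace ℂ (X s)] [∀ s, FiniteDimensional ℂ (X s)]

/-- The functional `T ↦ ⟨k, T Ω⟩` on the tensor algebra, where `Ω` is the vacuum. -/
def vacuumFunctional (S : SubproductSystem X) (k : Fock X) : S.tensorAlgebra →L[ℂ] ℂ :=
  (innerSL ℂ k).comp <| (ContinuousLinearMap.apply ℂ (Fock X) (lp.single 2 0 S.vac : Fock X)).comp
    (Subalgebra.toSubmodule S.tensorAlgebra).subtypeL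

/-- `L_η Ω = η`, so only the component of `k` in degree `s` contributes. -/
theorem vacuumFunctional_gen (S : SubproductSystem X) (k : Fock X) (s : ℕ × ℕ) (η : X s) :
    S.vacuumFunctional k (S.gen s η) = inner ℂ (k s) η := by
  change inner ℂ k (S.creation η (lp.single 2 0 S.vac)) = _
  rw [S.creation_single (add_zero s), S.mul_vac, lp.inner_single_right]

/-- The functional `η ↦ φ(L_η)` on `X s` defined by a character `φ`. -/
def charGen (S : SubproductSystem X) (φ : S.charSpace) (s : ℕ × ℕ) : X s →ₗ[ℂ] ℂ :=
  (WeakDual.CharacterSpace.toCLM φ).toLinearMap ∘ₗ S.gen s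

theorem charGen_apply (S : SubproductSystem X) (φ : S.charSpace) (s : ℕ × ℕ) (η : X s) :
    S.charGen φ s η = φ (S.gen s η) := rfl

theorem charGen_vac (S : SubproductSystem X) (φ : S.charSpace) : S.charGen φ 0 S.vac = 1 := by
  rw [charGen_apply, gen_vac, map_one]

theorem charGen_U (S : SubproductSystem X) (φ : S.charSpace) {s t r : ℕ × ℕ} (h : s + t = r)
    (η : X s) (ζ : X t) :
    S.charGen φ r (S.U h (η ⊗ₜ[ℂ] ζ)) = S.charGen φ s η * S.charGen φ t ζ := by
  rw [charGen_apply, ← gen_mul_gen, map_mul, charGen_apply, charGen_apply]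

theorem norm_charGen_le (S : SubproductSystem X) (φ : S.charSpace) (s : ℕ × ℕ) (η : X s) :
    ‖S.charGen φ s η‖ ≤ ‖η‖ :=
  (S.norm_char_apply_le φ _).trans (S.norm_gen_le s η)

theorem char_ext (S : SubproductSystem X) {φ ψ : S.charSpace}
    (h : ∀ s (η : X s), S.charGen φ s η = S.charGen ψ s η) : φ = ψ := by
  have h1 : WeakDual.CharacterSpace.toCLM φ = WeakDual.CharacterSpace.toCLM ψ := S.clm_ext_gen h
  exact WeakDual.CharacterSpace.ext fun T => DFunLike.congr_fun h1 T

theorem continuous_charGen (S : SubproductSystem X) (s : ℕ × ℕ) (η : X s) :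
    Continuous fun φ : S.charSpace => S.charGen φ s η :=
  (WeakDual.eval_continuous (S.gen s η)).comp continuous_subtype_val

/-- A square summable family of vectors `k_s` with `⟨k_{s+t}, U(η ⊗ ζ)⟩ = ⟨k_s, η⟩ ⟨k_t, ζ⟩`
defines a character. -/
theorem exists_char_of_family (S : SubproductSystem X) (k : ∀ s, X s)
    (hk : Summable fun s => ‖k s‖ ^ 2) (h0 : inner ℂ (k 0) S.vac = 1)
    (hmul : ∀ (s t : ℕ × ℕ) (η : X s) (ζ : X t),
      inner ℂ (k (t + s)) (S.U (add_comm s t) (η ⊗ₜ[ℂ] ζ)) = inner ℂ (k s) η * inner ℂ (k t) ζ) :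
    ∃ φ : S.charSpace, ∀ s (η : X s), S.charGen φ s η = inner ℂ (k s) η := by
  have hmem : Memℓp k 2 := memℓp_gen (by simpa using hk)
  have hgen := S.vacuumFunctional_gen ⟨k, hmem⟩
  refine ⟨⟨_, S.mem_charSpace_of_gen (S.vacuumFunctional ⟨k, hmem⟩) ?_ fun s t η ζ => ?_⟩, hgen⟩
  · rw [← gen_vac, hgen]
    exact h0
  · rw [S.gen_mul_gen (add_comm s t), hgen, hgen, hgen]
    exact hmul s t η ζ

end SubproductSystem

/-! ### Characters and kernel points. -/

namespace StandardSubproductSystem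

variable {E : Type u} {F : Type v} [NormedAddCommGroup E] [InnerProductSpace ℂ E]
  [FiniteDimensional ℂ E] [NormedAddCommGroup F] [InnerProductSpace ℂ F] [FiniteDimensional ℂ F]
  {X : StandardSubproductSystem E F} {U : F ⊗[ℂ] E ≃ₗᵢ[ℂ] E ⊗[ℂ] F}

/-- The functional `e ↦ φ(L_e)` on `E = X(1,0)`. -/
def charE (X : StandardSubproductSystem E F) (φ : X.sys.charSpace) (e : E) : ℂ :=
  X.sys.charGen φ (1, 0) (X.proj (1, 0) (embE E F e))

/-- The functional `f ↦ φ(L_f)` on `F = X(0,1)`. -/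
def charF (X : StandardSubproductSystem E F) (φ : X.sys.charSpace) (f : F) : ℂ :=
  X.sys.charGen φ (0, 1) (X.proj (0, 1) (embF E F f))

theorem norm_charE_le (X : StandardSubproductSystem E F) (φ : X.sys.charSpace) (e : E) :
    ‖X.charE φ e‖ ≤ ‖e‖ :=
  (X.sys.norm_charGen_le φ _ _).trans <|
    (Submodule.norm_orthogonalProjectionOnto_apply_le _ _).trans ((embE E F).norm_map e).le

theorem norm_charF_le (X : StandardSubproductSystem E F) (φ : X.sys.charSpace) (f : F) :
    ‖X.charF φ f‖ ≤ ‖f‖ :=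
  (X.sys.norm_charGen_le φ _ _).trans <|
    (Submodule.norm_orthogonalProjectionOnto_apply_le _ _).trans ((embF E F).norm_map f).le

theorem charGen_mul (hU : X.IsStructureUnitary U) (φ : X.sys.charSpace) (s t : ℕ × ℕ)
    (x : BiPow E F s) (y : BiPow E F t) :
    X.sys.charGen φ (t + s) (X.proj (t + s) (mulW U s t (x ⊗ₜ[ℂ] y))) =
      X.sys.charGen φ s (X.proj s x) * X.sys.charGen φ t (X.proj t y) :=
  (congrArg (X.sys.charGen φ (t + s)) (hU.apply_proj s t x y)).symm.trans
    (X.sys.charGen_U φ (add_comm s t) _ _)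

theorem IsStructureUnitary.charGen_proj (hU : X.IsStructureUnitary U) (φ : X.sys.charSpace)
    {a : E} {b : F} (ha : ∀ e, X.charE φ e = inner ℂ a e) (hb : ∀ f, X.charF φ f = inner ℂ b f)
    (s : ℕ × ℕ) (x : BiPow E F s) :
    X.sys.charGen φ s (X.proj s x) = inner ℂ (biPowVec a b s) x :=
  eq_inner_biPowVec U
    (fun s => X.sys.charGen φ s ∘ₗ (X.proj s : BiPow E F s →ₗ[ℂ] X.fiber s))
    ((congrArg (X.sys.charGen φ 0) hU.proj_vacuum).trans (X.sys.charGen_vac φ))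
    (charGen_mul hU φ) ha hb s x

theorem IsStructureUnitary.charGen_eq (hU : X.IsStructureUnitary U) (φ : X.sys.charSpace)
    {a : E} {b : F} (ha : ∀ e, X.charE φ e = inner ℂ a e) (hb : ∀ f, X.charF φ f = inner ℂ b f)
    (s : ℕ × ℕ) (η : X.fiber s) :
    X.sys.charGen φ s η = inner ℂ (biPowVec a b s) (η : BiPow E F s) :=
  (congrArg (X.sys.charGen φ s)
    (Submodule.orthogonalProjectionOnto_mem_subspace_eq_self η)).symm.trans
    (hU.charGen_proj φ ha hb s η)

/-- A pair `(a, b)` is a kernel point of `X` and `U` if all `a^{⊗ i} ⊗ b^{⊗ j}` lie in the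
fibres of `X` and `U` flips `b ⊗ a`. -/
structure IsKernelPoint (X : StandardSubproductSystem E F) (U : F ⊗[ℂ] E ≃ₗᵢ[ℂ] E ⊗[ℂ] F)
    (a : E) (b : F) : Prop where
  mem_fiber : ∀ s, biPowVec a b s ∈ X.fiber s
  flip : U (b ⊗ₜ[ℂ] a) = a ⊗ₜ[ℂ] b

/-- Both sides are the product of `f` and `e` in `X`; that `X(1,0)` and `X(0,1)` are full allows
arbitrary `e` and `f`. -/
theorem IsCommutationRelation.proj_embEF {u : F ⊗[ℂ] E ≃ₗᵢ[ℂ] E ⊗[ℂ] F}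
    (hu : X.IsCommutationRelation u) (hU : X.IsStructureUnitary U) (e : E) (f : F) :
    X.proj (1, 1) (embEF E F (u (f ⊗ₜ[ℂ] e))) = X.proj (1, 1) (embEF E F (U (f ⊗ₜ[ℂ] e))) := by
  have he : embE E F e ∈ X.fiber (1, 0) := by rw [X.fiber_one_zero]; trivial
  have hf : embF E F f ∈ X.fiber (0, 1) := by rw [X.fiber_zero_one]; trivial
  have h1 := hu ⟨_, he⟩ ⟨_, hf⟩
  have h2 := hU (0, 1) (1, 0) ⟨_, hf⟩ ⟨_, he⟩
  simp only [LinearIsometryEquiv.symm_apply_apply] at h1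
  rw [← mulW_embF_embE U]
  exact h1.trans h2

/-- The flip condition involves only pairings with `a ⊗ b`. This vector lies in `X(1,1)`, so the
pairings factor through the projection, where `u` and `U` agree. -/
theorem IsCommutationRelation.isKernelPoint_iff {u : F ⊗[ℂ] E ≃ₗᵢ[ℂ] E ⊗[ℂ] F}
    (hu : X.IsCommutationRelation u) (hU : X.IsStructureUnitary U) (a : E) (b : F) :
    X.IsKernelPoint u a b ↔ X.IsKernelPoint U a b := by
  have key (h : ∀ s, biPowVec a b s ∈ X.fiber s) (e : E) (f : F) :
      inner ℂ (a ⊗ₜ[ℂ] b) (u (f ⊗ₜ[ℂ] e)) = inner ℂ (a ⊗ₜ[ℂ] b) (U (f ⊗ₜ[ℂ] e)) := by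
    have h11 := h (1, 1)
    rw [biPowVec_one_one] at h11
    rw [← (embEF E F).inner_map_map, ← (embEF E F).inner_map_map (a ⊗ₜ[ℂ] b)]
    have h1 := Submodule.inner_orthogonalProjectionOnto_eq_of_mem_left (𝕜 := ℂ)
      (⟨_, h11⟩ : X.fiber (1, 1))
    rw [← h1, ← h1, hu.proj_embEF hU]
  constructor <;> rintro ⟨h1, h2⟩ <;> refine ⟨h1, ?_⟩ <;> rw [flip_iff_inner] at h2 ⊢ <;>
    intro e f
  · rw [← key h1, h2]
  · rw [key h1, h2]

/-- The point defined by a character is a kernel point. -/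
theorem IsStructureUnitary.isKernelPoint_of_char (hU : X.IsStructureUnitary U)
    (φ : X.sys.charSpace) {a : E} {b : F} (ha : ∀ e, X.charE φ e = inner ℂ a e)
    (hb : ∀ f, X.charF φ f = inner ℂ b f) : X.IsKernelPoint U a b := by
  have h := hU.charGen_proj φ ha hb
  refine ⟨fun s => ?_, ?_⟩
  -- The pairing with `a^{⊗ i} ⊗ b^{⊗ j}` factors through the projection onto `X(s)`, hence kills
  -- `X(s)ᗮ`.
  · rw [← Submodule.orthogonal_orthogonal (X.fiber s), Submodule.mem_orthogonal']
    intro x hx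
    rw [← h]
    exact (congrArg (X.sys.charGen φ s)
      (Submodule.orthogonalProjectionOnto_eq_zero_iff.2 hx)).trans (map_zero _)
  · rw [flip_iff_inner]
    intro e f
    rw [← (embEF E F).inner_map_map, ← biPowVec_one_one, ← mulW_embF_embE]
    refine (h (1, 1) _).symm.trans ?_
    refine (charGen_mul hU φ (0, 1) (1, 0) _ _).trans ?_
    exact congrArg₂ (· * ·) (hb f) (ha e)

/-- Contractivity at the vector `a` itself reads `‖a‖ ^ 2 ≤ ‖a‖`. -/
theorem norm_le_one_of_charE (φ : X.sys.charSpace) {a : E}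
    (ha : ∀ e, X.charE φ e = inner ℂ a e) : ‖a‖ ≤ 1 := by
  have h1 := X.norm_charE_le φ a
  rw [ha, inner_self_eq_norm_sq_to_K] at h1
  simp at h1
  nlinarith [norm_nonneg a]

theorem norm_le_one_of_charF (φ : X.sys.charSpace) {b : F}
    (hb : ∀ f, X.charF φ f = inner ℂ b f) : ‖b‖ ≤ 1 := by
  have h1 := X.norm_charF_le φ b
  rw [hb, inner_self_eq_norm_sq_to_K] at h1
  simp at h1
  nlinarith [norm_nonneg b]

/-- Every kernel point in the open polyball comes from a character. -/
theorem IsStructureUnitary.exists_char (hU : X.IsStructureUnitary U) {a : E} {b : F}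
    (h : X.IsKernelPoint U a b) (ha : ‖a‖ < 1) (hb : ‖b‖ < 1) :
    ∃ φ : X.sys.charSpace, (∀ e, X.charE φ e = inner ℂ a e) ∧
      ∀ f, X.charF φ f = inner ℂ b f := by
  let k (s : ℕ × ℕ) : X.fiber s := ⟨biPowVec a b s, h.mem_fiber s⟩
  have hk : Summable fun s => ‖k s‖ ^ 2 := by
    have h1 : (fun s => ‖k s‖ ^ 2) = fun s : ℕ × ℕ => (‖a‖ ^ 2) ^ s.1 * (‖b‖ ^ 2) ^ s.2 := by
      funext s
      change ‖biPowVec a b s‖ ^ 2 = _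
      rw [norm_biPowVec, mul_pow, pow_right_comm, pow_right_comm ‖b‖]
    rw [h1]
    -- A product of two geometric series; this is where both norms must be strictly less than 1.
    exact (summable_geometric_of_lt_one (by positivity)
      (pow_lt_one₀ (norm_nonneg a) ha two_ne_zero)).mul_of_nonneg
      (summable_geometric_of_lt_one (by positivity)
      (pow_lt_one₀ (norm_nonneg b) hb two_ne_zero)) (fun _ => by positivity) (fun _ => by positivity)
  have h0 : inner ℂ (k 0) X.sys.vac = 1 := by
    have h1 : k 0 = X.sys.vac := Subtype.ext hU.coe_vac.symm
    rw [h1, inner_self_eq_norm_sq_to_K, X.sys.norm_vac]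
    simp
  have hmul (s t : ℕ × ℕ) (η : X.fiber s) (ζ : X.fiber t) :
      inner ℂ (k (t + s)) (X.sys.U (add_comm s t) (η ⊗ₜ[ℂ] ζ)) =
        inner ℂ (k s) η * inner ℂ (k t) ζ := by
    rw [hU]
    refine (Submodule.inner_orthogonalProjectionOnto_eq_of_mem_left _ _).trans ?_
    exact inner_biPowVec_mulW h.flip s t η ζ
  obtain ⟨φ, hφ⟩ := X.sys.exists_char_of_family k hk h0 hmul
  have hφ' (s : ℕ × ℕ) (x : BiPow E F s) :
      X.sys.charGen φ s (X.proj s x) = inner ℂ (biPowVec a b s) x :=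
    (hφ s _).trans (Submodule.inner_orthogonalProjectionOnto_eq_of_mem_left _ _)
  refine ⟨φ, fun e => ?_, fun f => ?_⟩
  · refine (hφ' (1, 0) (embE E F e)).trans ?_
    rw [biPowVec_one_zero, LinearIsometryEquiv.inner_map_map]
  · refine (hφ' (0, 1) (embF E F f)).trans ?_
    rw [biPowVec_zero_one, LinearIsometryEquiv.inner_map_map]

theorem IsKernelPoint.smul {a : E} {b : F} (h : X.IsKernelPoint U a b) (c : ℂ) :
    X.IsKernelPoint U (c • a) (c • b) where
  mem_fiber s := by
    rw [biPowVec_smul]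
    exact Submodule.smul_mem _ _ (h.mem_fiber s)
  flip := by rw [TensorProduct.smul_tmul_smul, map_smul, h.flip, TensorProduct.smul_tmul_smul]

theorem IsStructureUnitary.char_ext (hU : X.IsStructureUnitary U) {φ ψ : X.sys.charSpace}
    {a : E} {b : F}
    (haφ : ∀ e, X.charE φ e = inner ℂ a e) (hbφ : ∀ f, X.charF φ f = inner ℂ b f)
    (haψ : ∀ e, X.charE ψ e = inner ℂ a e) (hbψ : ∀ f, X.charF ψ f = inner ℂ b f) : φ = ψ := by
  exact X.sys.char_ext fun s η =>
      (hU.charGen_eq φ haφ hbφ s η).trans (hU.charGen_eq ψ haψ hbψ s η).symm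

end StandardSubproductSystem

/-! ### Bihomogeneous polynomials. -/

section Bihomogeneous

variable {m n : ℕ}

theorem IsBihomogeneous.sub {p q : MvPolynomial (Fin m ⊕ Fin n) ℂ} {d d' : ℕ}
    (hp : IsBihomogeneous p d d') (hq : IsBihomogeneous q d d') : IsBihomogeneous (p - q) d d' := by
  classical
  intro c hc
  rcases Finset.mem_union.1 (MvPolynomial.support_sub _ p q hc) with h | h
  exacts [hp c h, hq c h]

theorem IsBihomogeneous.sum {ι : Type*} {A : Finset ι} {p : ι → MvPolynomial (Fin m ⊕ Fin n) ℂ}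
    {d d' : ℕ} (hp : ∀ i ∈ A, IsBihomogeneous (p i) d d') : IsBihomogeneous (∑ i ∈ A, p i) d d' := by
  classical
  intro c hc
  obtain ⟨i, hi, h⟩ := Finset.mem_biUnion.1 (MvPolynomial.support_sum hc)
  exact hp i hi c h

theorem IsBihomogeneous.mul {p q : MvPolynomial (Fin m ⊕ Fin n) ℂ} {d d' k k' : ℕ}
    (hp : IsBihomogeneous p d d') (hq : IsBihomogeneous q k k') :
    IsBihomogeneous (p * q) (d + k) (d' + k') := by
  classical
  intro c hc
  obtain ⟨a, ha, b, hb, rfl⟩ := Finset.mem_add.1 (MvPolynomial.support_mul p q hc)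
  simp only [Finsupp.add_apply, Finset.sum_add_distrib]
  exact ⟨by rw [(hp a ha).1, (hq b hb).1], by rw [(hp a ha).2, (hq b hb).2]⟩

theorem isBihomogeneous_C (c : ℂ) :
    IsBihomogeneous (MvPolynomial.C c : MvPolynomial (Fin m ⊕ Fin n) ℂ) 0 0 := by
  intro a ha
  obtain rfl := Finset.mem_singleton.1 (MvPolynomial.support_monomial_subset ha)
  simp

theorem isBihomogeneous_X_inl (i : Fin m) :
    IsBihomogeneous (MvPolynomial.X (Sum.inl i) : MvPolynomial (Fin m ⊕ Fin n) ℂ) 1 0 := by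
  intro a ha
  rw [MvPolynomial.support_X, Finset.mem_singleton] at ha
  subst ha
  simp [Finsupp.single_apply]

theorem isBihomogeneous_X_inr (j : Fin n) :
    IsBihomogeneous (MvPolynomial.X (Sum.inr j) : MvPolynomial (Fin m ⊕ Fin n) ℂ) 0 1 := by
  intro a ha
  rw [MvPolynomial.support_X, Finset.mem_singleton] at ha
  subst ha
  simp [Finsupp.single_apply]

theorem isBihomogeneous_prod_inl {k : ℕ} (a : Fin k → Fin m) :
    IsBihomogeneous (∏ l, MvPolynomial.X (Sum.inl (a l)) : MvPolynomial (Fin m ⊕ Fin n) ℂ) k 0 := by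
  induction k with
  | zero => simpa using isBihomogeneous_C 1
  | succ k ih =>
    have h := (isBihomogeneous_X_inl (a 0)).mul (ih fun l => a l.succ)
    rw [add_comm 1 k] at h
    rw [Fin.prod_univ_succ]
    exact h

theorem isBihomogeneous_prod_inr {k : ℕ} (a : Fin k → Fin n) :
    IsBihomogeneous (∏ l, MvPolynomial.X (Sum.inr (a l)) : MvPolynomial (Fin m ⊕ Fin n) ℂ) 0 k := by
  induction k with
  | zero => simpa using isBihomogeneous_C 1
  | succ k ih =>
    have h := (isBihomogeneous_X_inr (a 0)).mul (ih fun l => a l.succ)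
    rw [add_comm 1 k] at h
    rw [Fin.prod_univ_succ]
    exact h

end Bihomogeneous

theorem nonempty_homeomorph_of_range_eq {K : Type*} {Y : Type*} [TopologicalSpace K]
    [CompactSpace K] [TopologicalSpace Y] [T2Space Y] {g : K → Y} (hg : Continuous g)
    (hinj : Function.Injective g) {A : Set Y} (hA : Set.range g = A) : Nonempty (K ≃ₜ A) := by
  subst hA
  exact ⟨(hg.isClosedEmbedding hinj).isEmbedding.toHomeomorph⟩

/-! ### Evaluating the generators of the ideal at a point. -/

section Evaluation

variable {m n : ℕ} {E : Type u} {F : Type v} [NormedAddCommGroup E] [InnerProductSpace ℂ E]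
  [NormedAddCommGroup F] [InnerProductSpace ℂ F]

/-- The vector of `E` that represents the functional with values `z i` on the basis vectors. -/
def OrthonormalBasis.rieszVec (e : OrthonormalBasis (Fin m) ℂ E) (z : EuclideanSpace ℂ (Fin m)) : E :=
  ∑ i, starRingEnd ℂ (z i) • e i

theorem OrthonormalBasis.inner_rieszVec (e : OrthonormalBasis (Fin m) ℂ E)
    (z : EuclideanSpace ℂ (Fin m)) (x : E) :
    inner ℂ (e.rieszVec z) x = ∑ i, z i * inner ℂ (e i) x := by
  simp [OrthonormalBasis.rieszVec, mul_comm]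

theorem OrthonormalBasis.inner_rieszVec_self (e : OrthonormalBasis (Fin m) ℂ E)
    (z : EuclideanSpace ℂ (Fin m)) (i : Fin m) : inner ℂ (e.rieszVec z) (e i) = z i := by
  simp [OrthonormalBasis.inner_rieszVec, OrthonormalBasis.inner_eq_ite]

theorem OrthonormalBasis.norm_rieszVec (e : OrthonormalBasis (Fin m) ℂ E)
    (z : EuclideanSpace ℂ (Fin m)) : ‖e.rieszVec z‖ = ‖z‖ := by
  have h : e.repr (e.rieszVec z) = WithLp.toLp 2 fun i => starRingEnd ℂ (z i) := by
    ext i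
    rw [OrthonormalBasis.repr_apply_apply, ← inner_conj_symm, e.inner_rieszVec_self]
  rw [← e.repr.norm_map, h, EuclideanSpace.norm_eq, EuclideanSpace.norm_eq]
  simp

/-- `rieszVec` is conjugate linear, so the scalar is taken real; that suffices for shrinking a point
radially. -/
theorem OrthonormalBasis.rieszVec_smul (e : OrthonormalBasis (Fin m) ℂ E) (r : ℝ)
    (z : EuclideanSpace ℂ (Fin m)) : e.rieszVec ((r : ℂ) • z) = (r : ℂ) • e.rieszVec z := by
  simp [OrthonormalBasis.rieszVec, Finset.smul_sum, mul_smul]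

theorem inner_smul_tmul_smul (c d : ℂ) (x : E) (y : F) (z : E ⊗[ℂ] F) :
    inner ℂ ((c • x) ⊗ₜ[ℂ] (d • y)) z =
      starRingEnd ℂ c * starRingEnd ℂ d * inner ℂ (x ⊗ₜ[ℂ] y) z := by
  rw [TensorProduct.smul_tmul_smul, ← map_mul]
  exact inner_smul_left (𝕜 := ℂ) (E := E ⊗[ℂ] F) _ _ _

theorem powVec_rieszVec (e : OrthonormalBasis (Fin m) ℂ E) (z : EuclideanSpace ℂ (Fin m)) (k : ℕ) :
    powVec (e.rieszVec z) k =
      ∑ a : Fin k → Fin m, starRingEnd ℂ (∏ l, z (a l)) • elemTensor k fun l => e (a l) := by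
  induction k with
  | zero => simp [powVec_zero, elemTensor]
  | succ k ih =>
    rw [powVec_succ, ih, OrthonormalBasis.rieszVec, TensorProduct.sum_tmul, map_sum,
      ← (Fin.consEquiv fun _ => Fin m).sum_comp, Fintype.sum_prod_type]
    refine Finset.sum_congr rfl fun i _ => ?_
    rw [TensorProduct.tmul_sum, map_sum]
    refine Finset.sum_congr rfl fun a _ => ?_
    rw [TensorProduct.smul_tmul_smul, map_smul, Fin.prod_univ_succ, map_mul]
    rfl

/-- The conjugates in `rieszVec` are undone by the conjugate linear slot of the inner product. Thus
`q^x` vanishes at `(z, w)` exactly when `x` is orthogonal to `a^{⊗ i} ⊗ b^{⊗ j}`. -/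
theorem eval_tensorPoly (e : OrthonormalBasis (Fin m) ℂ E) (f : OrthonormalBasis (Fin n) ℂ F)
    (s : ℕ × ℕ) (x : BiPow E F s) (z : EuclideanSpace ℂ (Fin m)) (w : EuclideanSpace ℂ (Fin n)) :
    MvPolynomial.eval (Sum.elim z w) (tensorPoly e f s x) =
      inner ℂ (biPowVec (e.rieszVec z) (f.rieszVec w) s) x := by
  rw [biPowVec, powVec_rieszVec, powVec_rieszVec, TensorProduct.sum_tmul, sum_inner, tensorPoly,
    map_sum]
  refine Finset.sum_congr rfl fun a _ => ?_
  rw [TensorProduct.tmul_sum, sum_inner, map_sum]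
  refine Finset.sum_congr rfl fun b _ => ?_
  rw [inner_smul_tmul_smul]
  simp [map_prod, mul_comm]

/-- Vanishing of `p_{i,j}` is the identity of `flip_iff_inner` on a pair of basis vectors. -/
theorem eval_commPoly (u : F ⊗[ℂ] E ≃ₗᵢ[ℂ] E ⊗[ℂ] F) (e : OrthonormalBasis (Fin m) ℂ E)
    (f : OrthonormalBasis (Fin n) ℂ F) (i : Fin m) (j : Fin n)
    (z : EuclideanSpace ℂ (Fin m)) (w : EuclideanSpace ℂ (Fin n)) :
    MvPolynomial.eval (Sum.elim z w) (commPoly u e f i j) =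
      inner ℂ (f.rieszVec w) (f j) * inner ℂ (e.rieszVec z) (e i) -
        inner ℂ (e.rieszVec z ⊗ₜ[ℂ] f.rieszVec w) (u (f j ⊗ₜ[ℂ] e i)) := by
  rw [e.inner_rieszVec_self, f.inner_rieszVec_self, OrthonormalBasis.rieszVec,
    TensorProduct.sum_tmul, sum_inner, commPoly, map_sub, map_sum]
  congr 1
  · simp
  refine Finset.sum_congr rfl fun k _ => ?_
  rw [OrthonormalBasis.rieszVec, TensorProduct.tmul_sum, sum_inner, map_sum]
  refine Finset.sum_congr rfl fun l _ => ?_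
  rw [inner_smul_tmul_smul]
  simp
  ring

theorem flip_of_basis (u : F ⊗[ℂ] E ≃ₗᵢ[ℂ] E ⊗[ℂ] F) (e : OrthonormalBasis (Fin m) ℂ E)
    (f : OrthonormalBasis (Fin n) ℂ F) {a : E} {b : F}
    (h : ∀ i j, inner ℂ (a ⊗ₜ[ℂ] b) (u (f j ⊗ₜ[ℂ] e i)) = inner ℂ b (f j) * inner ℂ a (e i)) :
    u (b ⊗ₜ[ℂ] a) = a ⊗ₜ[ℂ] b := by
  have h1 : (innerSL ℂ (a ⊗ₜ[ℂ] b)).toLinearMap ∘ₗ u.toLinearEquiv.toLinearMap =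
      (innerSL ℂ (b ⊗ₜ[ℂ] a)).toLinearMap := by
    refine (f.toBasis.tensorProduct e.toBasis).ext fun p => ?_
    rw [Basis.tensorProduct_apply, f.coe_toBasis, e.coe_toBasis]
    exact (h p.2 p.1).trans (TensorProduct.inner_tmul (𝕜 := ℂ) ..).symm
  refine (flip_iff_inner u a b).2 fun x y => ?_
  rw [← TensorProduct.inner_tmul]
  exact LinearMap.congr_fun h1 (y ⊗ₜ[ℂ] x)

theorem isBihomogeneous_tensorPoly (e : OrthonormalBasis (Fin m) ℂ E)
    (f : OrthonormalBasis (Fin n) ℂ F) (s : ℕ × ℕ) (x : BiPow E F s) :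
    IsBihomogeneous (tensorPoly e f s x) s.1 s.2 := by
  refine IsBihomogeneous.sum fun a _ => IsBihomogeneous.sum fun b _ => ?_
  simpa using (isBihomogeneous_C _).mul
    ((isBihomogeneous_prod_inl a).mul (isBihomogeneous_prod_inr b))

theorem isBihomogeneous_commPoly (u : F ⊗[ℂ] E ≃ₗᵢ[ℂ] E ⊗[ℂ] F) (e : OrthonormalBasis (Fin m) ℂ E)
    (f : OrthonormalBasis (Fin n) ℂ F) (i : Fin m) (j : Fin n) :
    IsBihomogeneous (commPoly u e f i j) 1 1 := by
  refine IsBihomogeneous.sub ?_ (IsBihomogeneous.sum fun k _ => IsBihomogeneous.sum fun l _ => ?_)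
  · exact (isBihomogeneous_X_inr j).mul (isBihomogeneous_X_inl i)
  · exact ((isBihomogeneous_C _).mul (isBihomogeneous_X_inl k)).mul (isBihomogeneous_X_inr l)

end Evaluation

/-! ### The character space as a polyball variety. -/

namespace StandardSubproductSystem

variable {m n : ℕ} {E : Type u} {F : Type v} [NormedAddCommGroup E] [InnerProductSpace ℂ E]
  [FiniteDimensional ℂ E] [NormedAddCommGroup F] [InnerProductSpace ℂ F] [FiniteDimensional ℂ F]

theorem isBihomogeneousIdeal_charIdeal (X : StandardSubproductSystem E F)
    (u : F ⊗[ℂ] E ≃ₗᵢ[ℂ] E ⊗[ℂ] F) (e : OrthonormalBasis (Fin m) ℂ E)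
    (f : OrthonormalBasis (Fin n) ℂ F) : IsBihomogeneousIdeal (charIdeal X u e f) := by
  refine ⟨_, ?_, rfl⟩
  rintro _ (⟨i, j, rfl⟩ | ⟨s, x, -, rfl⟩)
  · exact ⟨1, 1, isBihomogeneous_commPoly u e f i j⟩
  · exact ⟨s.1, s.2, isBihomogeneous_tensorPoly e f s x⟩

theorem mem_polyballVariety_charIdeal (X : StandardSubproductSystem E F)
    (u : F ⊗[ℂ] E ≃ₗᵢ[ℂ] E ⊗[ℂ] F) (e : OrthonormalBasis (Fin m) ℂ E)
    (f : OrthonormalBasis (Fin n) ℂ F) (z : EuclideanSpace ℂ (Fin m))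
    (w : EuclideanSpace ℂ (Fin n)) :
    (z, w) ∈ polyballVariety (charIdeal X u e f : Set (MvPolynomial (Fin m ⊕ Fin n) ℂ)) ↔
      X.IsKernelPoint u (e.rieszVec z) (f.rieszVec w) ∧ ‖z‖ ≤ 1 ∧ ‖w‖ ≤ 1 := by
  refine and_congr_left fun _ => ⟨fun h => ⟨fun s => ?_, ?_⟩, fun h p hp => ?_⟩
  · rw [← Submodule.orthogonal_orthogonal (X.fiber s), Submodule.mem_orthogonal']
    intro x hx
    rw [← eval_tensorPoly]
    exact h _ (Ideal.subset_span (Or.inr ⟨s, x, hx, rfl⟩))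
  · refine flip_of_basis u e f fun i j => ?_
    have h1 := h _ (Ideal.subset_span (Or.inl ⟨i, j, rfl⟩))
    rw [eval_commPoly, sub_eq_zero] at h1
    exact h1.symm
  -- Evaluation at a point has an ideal as kernel, so it suffices to check generators.
  · have h1 : charIdeal X u e f ≤ RingHom.ker (MvPolynomial.eval (Sum.elim z w)) := by
      refine Ideal.span_le.2 ?_
      rintro _ (⟨i, j, rfl⟩ | ⟨s, x, hx, rfl⟩)
      · exact (eval_commPoly u e f i j z w).trans
          (sub_eq_zero.2 ((flip_iff_inner u _ _).1 h.flip _ _).symm)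
      · exact (eval_tensorPoly e f s x z w).trans
          (Submodule.inner_right_of_mem_orthogonal (h.mem_fiber s) hx)
    exact h1 hp

theorem charE_eq_inner (X : StandardSubproductSystem E F) (φ : X.sys.charSpace)
    (e : OrthonormalBasis (Fin m) ℂ E) (x : E) :
    X.charE φ x = inner ℂ (e.rieszVec (WithLp.toLp 2 fun i => X.charE φ (e i))) x := by
  have h : X.sys.charGen φ (1, 0) ∘ₗ (X.proj (1, 0) : BiPow E F (1, 0) →ₗ[ℂ] X.fiber (1, 0)) ∘ₗ
      (embE E F).toLinearEquiv.toLinearMap =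
      (innerSL ℂ (e.rieszVec (WithLp.toLp 2 fun i => X.charE φ (e i)))).toLinearMap := by
    refine e.toBasis.ext fun i => ?_
    rw [e.coe_toBasis]
    change X.charE φ (e i) = inner ℂ (e.rieszVec _) (e i)
    rw [e.inner_rieszVec_self]
  exact LinearMap.congr_fun h x

theorem charF_eq_inner (X : StandardSubproductSystem E F) (φ : X.sys.charSpace)
    (f : OrthonormalBasis (Fin n) ℂ F) (x : F) :
    X.charF φ x = inner ℂ (f.rieszVec (WithLp.toLp 2 fun i => X.charF φ (f i))) x := by
  have h : X.sys.charGen φ (0, 1) ∘ₗ (X.proj (0, 1) : BiPow E F (0, 1) →ₗ[ℂ] X.fiber (0, 1)) ∘ₗ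
      (embF E F).toLinearEquiv.toLinearMap =
      (innerSL ℂ (f.rieszVec (WithLp.toLp 2 fun i => X.charF φ (f i)))).toLinearMap := by
    refine f.toBasis.ext fun i => ?_
    rw [f.coe_toBasis]
    change X.charF φ (f i) = inner ℂ (f.rieszVec _) (f i)
    rw [f.inner_rieszVec_self]
  exact LinearMap.congr_fun h x

/-- The coordinates of a character with respect to orthonormal bases of `E` and `F`. -/
def charCoord (X : StandardSubproductSystem E F) (e : OrthonormalBasis (Fin m) ℂ E)
    (f : OrthonormalBasis (Fin n) ℂ F) (φ : X.sys.charSpace) :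
    EuclideanSpace ℂ (Fin m) × EuclideanSpace ℂ (Fin n) :=
  (WithLp.toLp 2 fun i => X.charE φ (e i), WithLp.toLp 2 fun j => X.charF φ (f j))

theorem continuous_charCoord (X : StandardSubproductSystem E F) (e : OrthonormalBasis (Fin m) ℂ E)
    (f : OrthonormalBasis (Fin n) ℂ F) : Continuous (X.charCoord e f) :=
  ((PiLp.continuous_toLp 2 _).comp
    (continuous_pi fun _ => X.sys.continuous_charGen _ _)).prodMk
  ((PiLp.continuous_toLp 2 _).comp
    (continuous_pi fun _ => X.sys.continuous_charGen _ _))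

theorem IsStructureUnitary.charCoord_injective {X : StandardSubproductSystem E F}
    {U : F ⊗[ℂ] E ≃ₗᵢ[ℂ] E ⊗[ℂ] F} (hU : X.IsStructureUnitary U)
    (e : OrthonormalBasis (Fin m) ℂ E) (f : OrthonormalBasis (Fin n) ℂ F) :
    Function.Injective (X.charCoord e f) := by
  intro φ ψ h
  obtain ⟨h1, h2⟩ := Prod.mk.inj h
  refine hU.char_ext (X.charE_eq_inner φ e) (X.charF_eq_inner φ f) (fun x => ?_) (fun x => ?_)
  · rw [h1]
    exact X.charE_eq_inner ψ e x
  · rw [h2]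
    exact X.charF_eq_inner ψ f x

theorem IsStructureUnitary.range_charCoord {X : StandardSubproductSystem E F}
    {U : F ⊗[ℂ] E ≃ₗᵢ[ℂ] E ⊗[ℂ] F} (hU : X.IsStructureUnitary U)
    (e : OrthonormalBasis (Fin m) ℂ E) (f : OrthonormalBasis (Fin n) ℂ F) :
    Set.range (X.charCoord e f) =
      {p | X.IsKernelPoint U (e.rieszVec p.1) (f.rieszVec p.2) ∧ ‖p.1‖ ≤ 1 ∧ ‖p.2‖ ≤ 1} := by
  apply Set.Subset.antisymm
  · rintro _ ⟨φ, rfl⟩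
    have ha := X.charE_eq_inner φ e
    have hb := X.charF_eq_inner φ f
    refine ⟨hU.isKernelPoint_of_char φ ha hb, ?_, ?_⟩
    · exact (e.norm_rieszVec _).symm.le.trans (norm_le_one_of_charE φ ha)
    · exact (f.norm_rieszVec _).symm.le.trans (norm_le_one_of_charF φ hb)
  · rintro ⟨z, w⟩ ⟨h, hz, hw⟩
    -- Points of the closed polyball may fail summability, so they are first shrunk by `r < 1`;
    -- closedness of the range then allows `r → 1`.
    have hmem : ∀ r : ℝ, r ∈ Set.Ico (0 : ℝ) 1 →
        ((r : ℂ) • z, (r : ℂ) • w) ∈ Set.range (X.charCoord e f) := by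
      rintro r ⟨hr0, hr1⟩
      have hnorm {k : ℕ} (y : EuclideanSpace ℂ (Fin k)) (hy : ‖y‖ ≤ 1) : ‖(r : ℂ) • y‖ < 1 := by
        rw [norm_smul, Complex.norm_real, Real.norm_of_nonneg hr0]
        nlinarith [norm_nonneg y]
      have hk := h.smul (r : ℂ)
      rw [← e.rieszVec_smul, ← f.rieszVec_smul] at hk
      obtain ⟨φ, h1, h2⟩ := hU.exists_char hk (by rw [e.norm_rieszVec]; exact hnorm z hz)
        (by rw [f.norm_rieszVec]; exact hnorm w hw)
      refine ⟨φ, Prod.ext ?_ ?_⟩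
      · ext i
        exact (h1 (e i)).trans (e.inner_rieszVec_self _ i)
      · ext j
        exact (h2 (f j)).trans (f.inner_rieszVec_self _ j)
    have hclosed : IsClosed (Set.range (X.charCoord e f)) := by
      have := X.sys.compactSpace_charSpace
      exact (isCompact_range (X.continuous_charCoord e f)).isClosed
    have hcont : Continuous fun r : ℝ => ((r : ℂ) • z, (r : ℂ) • w) := by fun_prop
    have h1 : (1 : ℝ) ∈ closure (Set.Ico (0 : ℝ) 1) := by
      rw [closure_Ico zero_ne_one]
      exact ⟨zero_le_one, le_rfl⟩
    have h2 := hclosed.closure_subset (map_mem_closure hcont h1 hmem)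
    simpa using h2

/-- The character space is homeomorphic to the polyball variety of `charIdeal`. -/
theorem nonempty_homeomorph_polyballVariety (X : StandardSubproductSystem E F)
    {u : F ⊗[ℂ] E ≃ₗᵢ[ℂ] E ⊗[ℂ] F} (hu : X.IsCommutationRelation u)
    (e : OrthonormalBasis (Fin m) ℂ E) (f : OrthonormalBasis (Fin n) ℂ F) :
    Nonempty (X.sys.charSpace ≃ₜ
      polyballVariety (charIdeal X u e f : Set (MvPolynomial (Fin m ⊕ Fin n) ℂ))) := by
  -- The unitary defining the product need not be the given `u`; the range is computed with `U` and
  -- then translated.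
  obtain ⟨U, hU⟩ : ∃ U, X.IsStructureUnitary U := X.exists_unitary
  have hrange : Set.range (X.charCoord e f) =
      polyballVariety (charIdeal X u e f : Set (MvPolynomial (Fin m ⊕ Fin n) ℂ)) := by
    rw [hU.range_charCoord e f]
    ext ⟨z, w⟩
    rw [mem_polyballVariety_charIdeal, hu.isKernelPoint_iff hU]
    rfl
  have := X.sys.compactSpace_charSpace
  exact nonempty_homeomorph_of_range_eq (X.continuous_charCoord e f) (hU.charCoord_injective e f)
    hrange

end StandardSubproductSystem

end

theorem mainTheorem1 {E : Type*} {F : Type*}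
    [NormedAddCommGroup E] [InnerProductSpace ℂ E] [FiniteDimensional ℂ E]
    [NormedAddCommGroup F] [InnerProductSpace ℂ F] [FiniteDimensional ℂ F]
    (m n : ℕ) (hm : finrank ℂ E = m) (hn : finrank ℂ F = n)
    (X : StandardSubproductSystem E F)
    (u : F ⊗[ℂ] E ≃ₗᵢ[ℂ] E ⊗[ℂ] F) (hu : X.IsCommutationRelation u) :
    (∃ J : Ideal (MvPolynomial (Fin m ⊕ Fin n) ℂ), IsBihomogeneousIdeal J ∧
      Nonempty (X.sys.charSpace ≃ₜ
        polyballVariety (J : Set (MvPolynomial (Fin m ⊕ Fin n) ℂ)))) ∧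
    ∀ (e : OrthonormalBasis (Fin m) ℂ E) (f : OrthonormalBasis (Fin n) ℂ F),
      IsBihomogeneousIdeal (charIdeal X u e f) ∧
      Nonempty (X.sys.charSpace ≃ₜ
        polyballVariety (charIdeal X u e f : Set (MvPolynomial (Fin m ⊕ Fin n) ℂ))) := by
  have main : ∀ (e : OrthonormalBasis (Fin m) ℂ E) (f : OrthonormalBasis (Fin n) ℂ F),
      IsBihomogeneousIdeal (charIdeal X u e f) ∧
      Nonempty (X.sys.charSpace ≃ₜ
        polyballVariety (charIdeal X u e f : Set (MvPolynomial (Fin m ⊕ Fin n) ℂ))) :=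
    fun e f => ⟨X.isBihomogeneousIdeal_charIdeal u e f, X.nonempty_homeomorph_polyballVariety hu e f⟩
  exact ⟨⟨_, main ((stdOrthonormalBasis ℂ E).reindex (finCongr hm))
    ((stdOrthonormalBasis ℂ F).reindex (finCongr hn))⟩, main⟩
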